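/- **Setting.** Let $\mathscr V$ be a Polish space, $\nu$ a $\sigma$-finite measure on $\mathscr V$ with $\nu(\{v\})=0$ for all $v\in\mathscr V$, and $N$ a Poisson random measure on $\mathscr V$ with mean intensity $\nu$. Let $f_1,\dots,f_n:\mathscr V\to[0,\infty)$ be measurable functions such that $\Lambda(\sum_{i=1}^n w_if_i)<\infty$ for all $w_1,\dots,w_n\ge 0$, where $\Lambda(g)=\int_{\mathscr V}(1-e^{-g})\,d\nu$, and put $\tau_i=N(f_i)=\int f_i\,dN$. Let $\mu,\Delta,a_0,a_1,\dots,a_k,\beta_1,\dots,\beta_k$ be real numbers, and for $w>0$ let $\varphi(\cdot\mid w)$ be the normal density with mean $\mu\Delta+\sum_{j=1}^k\beta_jw^{-a_j}$ and variance $w^{-2a_0}$ (the basic model, with mean $\mu\Delta+\beta w^{-1}$ and variance $w^{-1}$, is $k=1$, $a_1=1$, $a_0=\tfrac12$). Let $(\mathbf V,\mathbf W,\mathbf X)$ be random variables with values in $\mathscr V^n\times(0,\infty)^n\times\mathbb R^n$ whose joint law is the normalisation of the augmented likelihood $$\mathbb E\Big[\prod_{i=1}^n e^{-w_iN(f_i)}f_i(v_i)\,N(dv_i)\Big]\prod_{i=1}^n\varphi(x_i\mid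 w_i)\,dw_i\,dx_i ,$$ which after integrating out $\mathbf v$ and $\mathbf w$ is the likelihood $\int_{(0,\infty)^n}\prod_i\varphi(x_i\mid w_i)\,\mathbb E\big[\prod_i e^{-w_i\tau_i}\tau_i\big]\prod_idw_i$. (It is assumed that its total mass is not $0$; the total mass is always at most $1$.) Let $\mathbf p=\{C_1,\dots,C_{n(\mathbf p)}\}$ be the random partition of $\{1,\dots,n\}$ in which $i$ and $l$ are in the same cell iff $V_i=V_l$, and let $V_j^*$ be the common value of the $V_i$, $i\in C_j$. For $w\in(0,\infty)^n$ put $\Omega_n(v)=\sum_iw_if_i(v)$ and $\nu_{\Omega_n}(dv)=e^{-\Omega_n(v)}\nu(dv)$. **Proposition 3.1.** 1. For almost every value $(p,w,x)$ of $(\mathbf p,\mathbf W,\mathbf X)$, with $p=\{C_1,\dots,C_{n(p)}\}$: every constant $\int_{\mathscr V}\prod_{i\in C_j}f_i\,d\nu_{\Omega_n}$ is positive and finite, and conditionally on $(\mathbf p,\mathbf W,\mathbf X)=(p,w,x)$ the unique values $V_1^*,\dots,V^*_{n(p)}$ of $\mathbf V$ are independent with $$\mathbb P(V_j^*\in dv\mid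 p,w,x)=\frac{\big[\prod_{i\in C_j}f_i(v)\big]\nu_{\Omega_n}(dv)}{\int_{\mathscr V}\prod_{i\in C_j}f_i\,d\nu_{\Omega_n}},\qquad j=1,\dots,n(p).$$ 2. For almost every value $(w,x)$ of $(\mathbf W,\mathbf X)$: the sum $\sum_q\prod_{C\in q}\int_{\mathscr V}\prod_{i\in C}f_i\,d\nu_{\Omega_n}$ over all partitions $q$ of $\{1,\dots,n\}$ is positive and finite, and for every partition $p$ of $\{1,\dots,n\}$ $$\mathbb P(\mathbf p=p\mid w,x)=\frac{\prod_{C\in p}\int_{\mathscr V}\big[\prod_{i\in C}f_i(v)\big]\nu_{\Omega_n}(dv)}{\sum_{q}\prod_{C\in q}\int_{\mathscr V}\big[\prod_{i\in C}f_i(v)\big]\nu_{\Omega_n}(dv)} .$$ -/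

import Mathlib

open MeasureTheory ProbabilityTheory Set
open scoped ENNReal NNReal

noncomputable section

namespace GHVolatility

/-! ### Partitions of `{1, …, n}`

A partition of `Fin n` is encoded by its equivalence relation `p : Setoid (Fin n)`; its cells are
the elements of `Quotient p`, and the number of cells is the cardinality of `Quotient p`. -/

/-- The finite set of partitions of `Fin n` carries the discrete σ-algebra. -/
instance instMeasurableSpacePartition (n : ℕ) : MeasurableSpace (Setoid (Fin n)) := ⊤

instance instDiscretePartition (n : ℕ) : DiscreteMeasurableSpace (Setoid (Fin n)) :=
  ⟨fun _ => trivial⟩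

instance instFinitePartition (n : ℕ) : Finite (Setoid (Fin n)) :=
  Finite.of_injective (fun (s : Setoid (Fin n)) => fun (i j : Fin n) => s i j) (fun _ _ h =>
    Setoid.ext (fun a b => iff_of_eq (congrFun (congrFun h a) b)))

instance instFintypePartition (n : ℕ) : Fintype (Setoid (Fin n)) := Fintype.ofFinite _

instance instFintypeCells {n : ℕ} (p : Setoid (Fin n)) : Fintype (Quotient p) := Fintype.ofFinite _

open Classical in
/-- The cell `C_j ⊆ {1, …, n}` of the partition `p` with label `j`. -/
def cell {n : ℕ} (p : Setoid (Fin n)) (j : Quotient p) : Finset (Fin n) :=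
  Finset.univ.filter (fun i => Quotient.mk p i = j)

/-- The partition of the indices generated by the ties of `v = (v_1, …, v_n)`: two indices are in
the same cell iff the values agree. -/
def tiePartition {n : ℕ} {𝓥 : Type*} (v : Fin n → 𝓥) : Setoid (Fin n) := Setoid.ker v

/-- The vector `(v_1, …, v_n)` whose value on the cell `C_j` of `p` is `u_j`. -/
def spread {n : ℕ} {𝓥 : Type*} (p : Setoid (Fin n)) (u : Quotient p → 𝓥) : Fin n → 𝓥 :=
  fun i => u (Quotient.mk p i)

/-! ### Poisson random measures -/

/-- `N` is a Poisson random measure with (σ-finite) mean intensity `ν`: `N(B)` is Poisson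
distributed with mean `ν(B)` whenever `ν(B) < ∞`, and the values of `N` on finitely many pairwise
disjoint measurable sets are independent. -/
structure IsPoissonRandomMeasure {Ω₀ 𝓥 : Type*} [MeasurableSpace Ω₀] [MeasurableSpace 𝓥]
    (N : Ω₀ → Measure 𝓥) (ν : Measure 𝓥) (P₀ : Measure Ω₀) : Prop where
  measurable : Measurable N
  map_apply : ∀ B : Set 𝓥, MeasurableSet B → ν B ≠ ∞ →
    P₀.map (fun ω => N ω B) =
      (poissonMeasure (ν B).toNNReal).map (fun k : ℕ => (k : ℝ≥0∞))
  iIndepFun : ∀ (k : ℕ) (B : Fin k → Set 𝓥), (∀ i, MeasurableSet (B i)) →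
    Pairwise (fun i j => Disjoint (B i) (B j)) →
    iIndepFun (fun i ω => N ω (B i)) P₀

section Model

variable {n : ℕ} {𝓥 : Type*} [MeasurableSpace 𝓥]

/-- `Ω_n(v) = ∑ i, w_i f_i(v)`. -/
def Omega (f : Fin n → 𝓥 → ℝ≥0) (w : Fin n → ℝ) (v : 𝓥) : ℝ := ∑ i, w i * (f i v : ℝ)

/-- `Λ(g) = ∫ (1 - e^{-g}) dν`. -/
def Lam (ν : Measure 𝓥) (g : 𝓥 → ℝ) : ℝ≥0∞ :=
  ∫⁻ v, ENNReal.ofReal (1 - Real.exp (-(g v))) ∂ν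

/-- The tilted intensity `ν_{Ω_n}(dv) = e^{-Ω_n(v)} ν(dv)`. -/
def tilted (ν : Measure 𝓥) (f : Fin n → 𝓥 → ℝ≥0) (w : Fin n → ℝ) : Measure 𝓥 :=
  ν.withDensity (fun v => ENNReal.ofReal (Real.exp (-(Omega f w v))))

/-- The linear functional `N(g) = ∫ g dN`. -/
def linFun (m : Measure 𝓥) (g : 𝓥 → ℝ≥0) : ℝ≥0∞ := ∫⁻ v, (g v : ℝ≥0∞) ∂m

/-- The conditional density of one observation given the latent `w > 0`: normal with mean
`μ Δ + ∑ j, β_j w ^ (-a_j)` and variance `w ^ (-2 a₀)`. The basic model, with mean `μ Δ + β w⁻¹`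
and variance `w⁻¹`, is `k = 1`, `a_1 = 1`, `a₀ = 1/2`. -/
def obsDensity {k : ℕ} (μ Δ a₀ : ℝ) (a β : Fin k → ℝ) (w x : ℝ) : ℝ≥0∞ :=
  gaussianPDF (μ * Δ + ∑ j, β j * w ^ (-a j)) (Real.toNNReal (w ^ (-2 * a₀))) x

/-- The integral of `g(v, w, x)` against the augmented likelihood
`E[∏ i, e^{-w_i τ_i} f_i(v_i) N(dv_i)] ∏ i, φ(x_i | w_i) dw_i dx_i`, where `τ_i = N(f_i)`,
`v ∈ 𝓥ⁿ`, `w ∈ (0,∞)ⁿ`, `x ∈ ℝⁿ`. Integrating out `v` produces the factor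
`E[∏ i, e^{-w_i τ_i} τ_i]`, and integrating out also `w` produces the likelihood of `x`. -/
def augmentedIntegral {Ω₀ : Type*} [MeasurableSpace Ω₀] {k : ℕ}
    (P₀ : Measure Ω₀) (N : Ω₀ → Measure 𝓥) (f : Fin n → 𝓥 → ℝ≥0)
    (μ Δ a₀ : ℝ) (a β : Fin k → ℝ)
    (g : (Fin n → 𝓥) × (Fin n → ℝ) × (Fin n → ℝ) → ℝ≥0∞) : ℝ≥0∞ :=
  ∫⁻ ω, (∫⁻ w in Set.univ.pi (fun _ => Ioi (0 : ℝ)), (∫⁻ x : Fin n → ℝ,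
    (∏ i, ENNReal.ofReal (Real.exp (-(w i * (linFun (N ω) (f i)).toReal)))) *
    (∏ i, obsDensity μ Δ a₀ a β (w i) (x i)) *
    (∫⁻ v, g (v, w, x) * ∏ i, (f i (v i) : ℝ≥0∞) ∂(Measure.pi fun _ : Fin n => N ω)))) ∂P₀

/-- The random variables `(V, W, X)` are distributed according to the normalised augmented
likelihood. The constant `c` is determined by `P` being a probability measure (it is `1` when all
`τ_i` are almost surely positive). -/
structure IsAugmentedSample {Ω₀ Ω : Type*} [MeasurableSpace Ω₀] [MeasurableSpace Ω] {k : ℕ}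
    (P₀ : Measure Ω₀) (N : Ω₀ → Measure 𝓥) (f : Fin n → 𝓥 → ℝ≥0)
    (μ Δ a₀ : ℝ) (a β : Fin k → ℝ)
    (P : Measure Ω) (V : Ω → Fin n → 𝓥) (W X : Ω → Fin n → ℝ) : Prop where
  measurable_V : Measurable V
  measurable_W : Measurable W
  measurable_X : Measurable X
  law : ∃ c : ℝ≥0∞, ∀ g : (Fin n → 𝓥) × (Fin n → ℝ) × (Fin n → ℝ) → ℝ≥0∞, Measurable g →
    ∫⁻ ω, g (V ω, W ω, X ω) ∂P = c * augmentedIntegral P₀ N f μ Δ a₀ a β g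

/-- The measure `[∏_{i ∈ C} f_i(v)] ν_{Ω_n}(dv)` on `𝓥`. -/
def cellMeasure (ν : Measure 𝓥) (f : Fin n → 𝓥 → ℝ≥0) (w : Fin n → ℝ) (C : Finset (Fin n)) :
    Measure 𝓥 :=
  (tilted ν f w).withDensity (fun v => ∏ i ∈ C, (f i v : ℝ≥0∞))

/-- The normalising constant `∫ [∏_{i ∈ C} f_i(v)] ν_{Ω_n}(dv)`. -/
def cellMass (ν : Measure 𝓥) (f : Fin n → 𝓥 → ℝ≥0) (w : Fin n → ℝ) (C : Finset (Fin n)) : ℝ≥0∞ :=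
  ∫⁻ v, ∏ i ∈ C, (f i v : ℝ≥0∞) ∂(tilted ν f w)

/-- The weight `∏_j ∫ [∏_{i ∈ C_j} f_i(v)] ν_{Ω_n}(dv)` of the partition `p`. -/
def partitionWeight (ν : Measure 𝓥) (f : Fin n → 𝓥 → ℝ≥0) (w : Fin n → ℝ)
    (p : Setoid (Fin n)) : ℝ≥0∞ :=
  ∏ j : Quotient p, cellMass ν f w (cell p j)

/-- The law on `𝓥` of the value attached to a cell `C`: `[∏_{i ∈ C} f_i(v)] ν_{Ω_n}(dv)`,
normalised. -/
def cellLaw (ν : Measure 𝓥) (f : Fin n → 𝓥 → ℝ≥0) (w : Fin n → ℝ) (C : Finset (Fin n)) :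
    Measure 𝓥 :=
  (cellMass ν f w C)⁻¹ • cellMeasure ν f w C

end Model

end GHVolatility

end

open MeasureTheory ProbabilityTheory Set
open scoped ENNReal NNReal

noncomputable section

namespace GHVolatility

/-! ### The Poisson law on the integers: Laplace transform and mean. -/

section Poisson

/-! Integrating the augmented likelihood over `v` in a box `∏ A_i` turns `f_i(v_i) N(dv_i)` into
`N(f_i 1_{A_i})`. Everything therefore rests on the moments `E[e^{-N(g)} ∏ N(h_i)]` with `g = Ω_n`
and `h_i = f_i 1_{A_i}`, which equal `e^{-Λ(g)} ∑_p ∏_{C ∈ p} ∫ ∏_{i ∈ C} h_i e^{-g} dν`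
(`integral_exp_neg_mul_prod`).

The moment formula is proved by induction on the number of factors. The base case is the Laplace
functional `integral_exp_neg_linFun`. For the step, `g` is replaced by `g + t h_0` and both sides
are differentiated at `t = 0` from the right. On the left a factor `-N(h_0)` comes down. On the
right, differentiating `e^{-Λ}` creates the cell `{0}`, and differentiating the factor of a cell `C`
adjoins `0` to `C`; this is the recursion `sum_partition_succ` for partitions. The interchanges of
limit and integral rest on `x^k e^{-x} ≤ k! (1 - e^{-x})`, `k ≥ 1`, and on the finiteness of `Λ`.

Comparing measures on boxes, the law of `(W, X, V)` is a finite mixture over partitions `p`: `(W,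
X)` has density `ρ(w, x)` times the weight of `p`, and given `(w, x)` one independent value per cell
is drawn from the normalised cell measure and copied along the cell (`exists_map_eq`). Since `ν` has
no atoms, values of different cells almost surely differ, so the ties of `V` recover the mixture
index `p` (`ae_tiePartition_cellsLaw`). Both conditional laws are then read off from this joint law;
the factor `ρ` depends on neither `p` nor `v` and drops out. -/

lemma integral_exp_neg_mul_poissonMeasure (r : ℝ≥0) (c : ℝ) :
    ∫ k : ℕ, Real.exp (-(c * k)) ∂(poissonMeasure r) =
      Real.exp (-((r : ℝ) * (1 - Real.exp (-c)))) := by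
  rw [integral_poissonMeasure]
  have h := (NormedSpace.expSeries_div_hasSum_exp ((r : ℝ) * Real.exp (-c))).mul_left
    (Real.exp (-(r : ℝ)))
  rw [← Real.exp_eq_exp_ℝ, ← Real.exp_add] at h
  have e : -((r : ℝ) * (1 - Real.exp (-c))) = -(r : ℝ) + r * Real.exp (-c) := by ring
  rw [e, ← h.tsum_eq]
  congr with k
  rw [mul_pow, ← Real.exp_nat_mul, smul_eq_mul]
  have : -(c * k) = k * -c := by ring
  rw [this]
  ring

lemma lintegral_natCast_poissonMeasure (r : ℝ≥0) :
    ∫⁻ k : ℕ, (k : ℝ≥0∞) ∂(poissonMeasure r) = r := by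
  rw [poissonMeasure, lintegral_sum_measure]
  simp only [lintegral_smul_measure, lintegral_dirac, smul_eq_mul]
  have h := (NormedSpace.expSeries_div_hasSum_exp (r : ℝ)).mul_left (Real.exp (-(r : ℝ)) * r)
  rw [← Real.exp_eq_exp_ℝ, mul_right_comm, ← Real.exp_add, neg_add_cancel, Real.exp_zero,
    one_mul] at h
  -- The term `k = 0` vanishes; after the shift the factor `k + 1` cancels against `(k + 1)!`.
  rw [tsum_eq_zero_add' ENNReal.summable]
  simp only [Nat.cast_zero, mul_zero, zero_add]
  have h2 : ∀ k : ℕ, ENNReal.ofReal (Real.exp (-r) * r ^ (k + 1) / (k + 1).factorial) *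
      ((k + 1 : ℕ) : ℝ≥0∞) = ENNReal.ofReal (Real.exp (-r) * r * (r ^ k / k.factorial)) := by
    intro k
    rw [← ENNReal.ofReal_natCast, ← ENNReal.ofReal_mul (by positivity)]
    congr 1
    rw [Nat.factorial_succ]
    push_cast
    field_simp
    ring
  simp_rw [h2]
  rw [← ENNReal.ofReal_tsum_of_nonneg (fun k => by positivity) h.summable, h.tsum_eq,
    ENNReal.ofReal_coe_nnreal]

end Poisson

/-! ### Poisson random measures: mean measure, almost sure finiteness, Laplace functional. -/

namespace IsPoissonRandomMeasure

variable {Ω₀ 𝓥 : Type*} [MeasurableSpace Ω₀] [MeasurableSpace 𝓥]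
  {N : Ω₀ → Measure 𝓥} {ν : Measure 𝓥} {P₀ : Measure Ω₀}

lemma measurable_apply (hN : IsPoissonRandomMeasure N ν P₀) {B : Set 𝓥} (hB : MeasurableSet B) :
    Measurable fun ω => N ω B :=
  (Measure.measurable_coe hB).comp hN.measurable

lemma measurable_linFun (hN : IsPoissonRandomMeasure N ν P₀) {g : 𝓥 → ℝ≥0} (hg : Measurable g) :
    Measurable fun ω => linFun (N ω) g :=
  (Measure.measurable_lintegral hg.coe_nnreal_ennreal).comp hN.measurable

/-- Integrality gives finiteness of `N` on sets of finite intensity, and also forces a mass below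
`1` to be `0`, which is used for unbounded integrands. -/
lemma ae_exists_nat (hN : IsPoissonRandomMeasure N ν P₀) {B : Set 𝓥} (hB : MeasurableSet B)
    (hνB : ν B ≠ ∞) : ∀ᵐ ω ∂P₀, ∃ k : ℕ, N ω B = k := by
  have hm : MeasurableSet {x : ℝ≥0∞ | ∃ k : ℕ, x = k} := by
    have : {x : ℝ≥0∞ | ∃ k : ℕ, x = k} = range (Nat.cast : ℕ → ℝ≥0∞) := by
      ext x; simp [eq_comm]
    rw [this]
    exact (countable_range (Nat.cast : ℕ → ℝ≥0∞)).measurableSet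
  have h : ∀ᵐ x : ℝ≥0∞ ∂(P₀.map fun ω => N ω B), ∃ k : ℕ, x = k := by
    rw [hN.map_apply B hB hνB, ae_map_iff Measurable.of_discrete.aemeasurable hm]
    exact Filter.Eventually.of_forall fun k => ⟨k, rfl⟩
  exact ae_of_ae_map (hN.measurable_apply hB).aemeasurable h

lemma lintegral_apply_of_ne_top (hN : IsPoissonRandomMeasure N ν P₀) {B : Set 𝓥}
    (hB : MeasurableSet B) (hνB : ν B ≠ ∞) : ∫⁻ ω, N ω B ∂P₀ = ν B := by
  have h : ∫⁻ x, x ∂(P₀.map fun ω => N ω B) = ∫⁻ ω, N ω B ∂P₀ :=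
    lintegral_map measurable_id (hN.measurable_apply hB)
  rw [← h, hN.map_apply B hB hνB, lintegral_map (f := fun x => x) measurable_id (by fun_prop)]
  simp only [lintegral_natCast_poissonMeasure]
  exact ENNReal.coe_toNNReal hνB

/-- Campbell's formula as an equality of measures: the sets of finite intensity form a π-system,
which generates because `ν` is σ-finite. -/
lemma bind_eq [SigmaFinite ν] (hN : IsPoissonRandomMeasure N ν P₀) : P₀.bind N = ν := by
  symm
  refine Measure.ext_of_generateFrom_of_iUnion {B | MeasurableSet B ∧ ν B ≠ ∞} (spanningSets ν)
    ?_ ?_ (iUnion_spanningSets ν) (fun i => ⟨measurableSet_spanningSets ν i,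
      (measure_spanningSets_lt_top ν i).ne⟩) (fun i => (measure_spanningSets_lt_top ν i).ne) ?_
  · apply le_antisymm
    · intro s hs
      have : s = ⋃ i, s ∩ spanningSets ν i := by
        rw [← inter_iUnion, iUnion_spanningSets, inter_univ]
      rw [this]
      refine MeasurableSet.iUnion fun i => MeasurableSpace.measurableSet_generateFrom
        ⟨hs.inter (measurableSet_spanningSets ν i), ?_⟩
      exact measure_ne_top_of_subset inter_subset_right (measure_spanningSets_lt_top ν i).ne
    · exact MeasurableSpace.generateFrom_le fun s hs => hs.1
  · rintro s hs t ht -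
    exact ⟨hs.1.inter ht.1, measure_ne_top_of_subset inter_subset_left hs.2⟩
  · rintro s ⟨hs, hs'⟩
    rw [Measure.bind_apply hs hN.measurable.aemeasurable, hN.lintegral_apply_of_ne_top hs hs']

/-- Needed for Tonelli on the product of copies of `N ω` in the augmented likelihood. The exhausting
sets of `ν` serve for `N ω` as well. -/
lemma ae_sigmaFinite [SigmaFinite ν] (hN : IsPoissonRandomMeasure N ν P₀) :
    ∀ᵐ ω ∂P₀, SigmaFinite (N ω) := by
  have h : ∀ᵐ ω ∂P₀, ∀ i, ∃ k : ℕ, N ω (spanningSets ν i) = k :=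
    ae_all_iff.2 fun i => hN.ae_exists_nat (measurableSet_spanningSets ν i)
      (measure_spanningSets_lt_top ν i).ne
  filter_upwards [h] with ω hω
  refine ⟨⟨⟨spanningSets ν, fun _ => trivial, fun i => ?_, iUnion_spanningSets ν⟩⟩⟩
  obtain ⟨k, hk⟩ := hω i
  rw [hk]
  exact ENNReal.natCast_lt_top k

lemma lintegral_lintegral [SigmaFinite ν] (hN : IsPoissonRandomMeasure N ν P₀) {g : 𝓥 → ℝ≥0∞}
    (hg : Measurable g) : ∫⁻ ω, ∫⁻ v, g v ∂(N ω) ∂P₀ = ∫⁻ v, g v ∂ν := by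
  rw [← Measure.lintegral_bind hN.measurable.aemeasurable hg.aemeasurable, hN.bind_eq]

/-- `N(g)` is almost surely finite on a set of finite intensity. -/
lemma ae_setLIntegral_lt_top (hN : IsPoissonRandomMeasure N ν P₀) {g : 𝓥 → ℝ≥0}
    (hg : Measurable g) {B : Set 𝓥} (hB : MeasurableSet B) (hνB : ν B ≠ ∞) :
    ∀ᵐ ω ∂P₀, ∫⁻ v in B, (g v : ℝ≥0∞) ∂(N ω) < ∞ := by
  have hD : ∀ m : ℕ, MeasurableSet (B ∩ {v | (m : ℝ≥0) < g v}) := fun m =>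
    hB.inter (measurableSet_lt measurable_const hg)
  have hDf : ∀ m : ℕ, ν (B ∩ {v | (m : ℝ≥0) < g v}) ≠ ∞ := fun m =>
    measure_ne_top_of_subset inter_subset_left hνB
  have h : ∀ᵐ ω ∂P₀, ∀ m : ℕ, ∃ k : ℕ, N ω (B ∩ {v | (m : ℝ≥0) < g v}) = k :=
    ae_all_iff.2 fun m => hN.ae_exists_nat (hD m) (hDf m)
  filter_upwards [h, hN.ae_exists_nat hB hνB] with ω hω hωB
  obtain ⟨kB, hkB⟩ := hωB
  have hanti : Antitone fun m : ℕ => B ∩ {v | (m : ℝ≥0) < g v} := by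
    intro a b hab v hv
    have hab' : (a : ℝ≥0) ≤ b := by exact_mod_cast hab
    exact ⟨hv.1, hab'.trans_lt hv.2⟩
  have hempty : ⋂ m : ℕ, B ∩ {v | (m : ℝ≥0) < g v} = ∅ := by
    refine eq_empty_of_forall_notMem fun v hv => ?_
    obtain ⟨m, hm⟩ := exists_nat_gt (g v)
    exact lt_asymm hm (mem_iInter.1 hv m).2
  -- The masses of the decreasing sets `B ∩ {g > m}` are integers tending to `0`, so one of them is
  -- `0`; for that `m`, `g ≤ m` holds `N ω`-almost everywhere on `B`.
  have hlim := tendsto_measure_iInter_atTop (μ := N ω) (fun m => (hD m).nullMeasurableSet) hanti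
    ⟨0, by obtain ⟨k, hk⟩ := hω 0; rw [hk]; exact ENNReal.natCast_ne_top k⟩
  rw [hempty, measure_empty] at hlim
  obtain ⟨m, hm⟩ := (hlim.eventually (gt_mem_nhds zero_lt_one)).exists
  obtain ⟨k, hk⟩ := hω m
  have hk0 : k = 0 := by
    rw [Function.comp_apply, hk] at hm
    exact Nat.lt_one_iff.1 (by exact_mod_cast hm)
  rw [hk0, Nat.cast_zero] at hk
  have hae : ∀ᵐ v ∂((N ω).restrict B), (g v : ℝ≥0∞) ≤ (m : ℝ≥0∞) := by
    rw [ae_restrict_iff' hB, ae_iff]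
    refine measure_mono_null (fun v hv => ?_) hk
    simp only [Classical.not_imp, not_le, mem_ofPred_eq] at hv
    exact ⟨hv.1, by exact_mod_cast hv.2⟩
  calc ∫⁻ v in B, (g v : ℝ≥0∞) ∂(N ω) ≤ ∫⁻ _ in B, (m : ℝ≥0∞) ∂(N ω) := lintegral_mono_ae hae
    _ = m * kB := by rw [setLIntegral_const, hkB]
    _ < ∞ := ENNReal.mul_lt_top (ENNReal.natCast_lt_top _) (ENNReal.natCast_lt_top _)

/-- `N(g)` is almost surely finite if `Λ(g)` is finite. -/
lemma ae_linFun_lt_top [SigmaFinite ν] (hN : IsPoissonRandomMeasure N ν P₀) {g : 𝓥 → ℝ≥0}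
    (hg : Measurable g) (hΛ : Lam ν (fun v => g v) < ∞) : ∀ᵐ ω ∂P₀, linFun (N ω) g < ∞ := by
  -- Large and small values of `g` are separated. On `B` the integrand of `Λ` is at least `1/2`, so
  -- `ν B` is finite. Off `B`, `g ≤ 2 (1 - e^{-g})`, so `N(g 1_{Bᶜ})` even has finite mean.
  set B : Set 𝓥 := {v | 1 < g v} with hBdef
  have hB : MeasurableSet B := measurableSet_lt measurable_const hg
  have hpt : ∀ x : ℝ, 0 ≤ x → x ≤ 1 → x ≤ 2 * (1 - Real.exp (-x)) := by
    intro x h0 h1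
    have h2 := Real.add_one_le_exp x
    have h3 : Real.exp (-x) * Real.exp x = 1 := by rw [← Real.exp_add]; simp
    have h4 := Real.exp_pos (-x)
    nlinarith
  have h12 : (1 : ℝ) / 2 ≤ 1 - Real.exp (-1) := by
    have := hpt 1 zero_le_one le_rfl
    linarith
  have hνB : ν B ≠ ∞ := by
    have hle : ENNReal.ofReal (1 / 2) * ν B ≤ Lam ν (fun v => g v) := by
      calc ENNReal.ofReal (1 / 2) * ν B = ∫⁻ _ in B, ENNReal.ofReal (1 / 2) ∂ν := by
            rw [setLIntegral_const]
        _ ≤ ∫⁻ v in B, ENNReal.ofReal (1 - Real.exp (-(g v : ℝ))) ∂ν := by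
            refine setLIntegral_mono (by fun_prop) fun v hv => ENNReal.ofReal_le_ofReal ?_
            have : (1 : ℝ) < g v := by exact_mod_cast hv
            have : Real.exp (-(g v : ℝ)) ≤ Real.exp (-1) := Real.exp_le_exp.2 (by linarith)
            linarith
        _ ≤ _ := setLIntegral_le_lintegral _ _
    intro htop
    rw [htop, ENNReal.mul_top (by simp)] at hle
    exact (hle.trans_lt hΛ).ne rfl
  have hBc : ∫⁻ v in Bᶜ, (g v : ℝ≥0∞) ∂ν ≠ ∞ := by
    refine ne_top_of_le_ne_top (ENNReal.mul_ne_top ENNReal.ofNat_ne_top hΛ.ne)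
      (b := 2 * Lam ν (fun v => g v)) ?_
    calc ∫⁻ v in Bᶜ, (g v : ℝ≥0∞) ∂ν
        ≤ ∫⁻ v in Bᶜ, 2 * ENNReal.ofReal (1 - Real.exp (-(g v : ℝ))) ∂ν := by
          refine setLIntegral_mono (by fun_prop) fun v hv => ?_
          have h1 : (g v : ℝ) ≤ 1 := by
            have : g v ≤ 1 := not_lt.1 hv
            exact_mod_cast this
          rw [← ENNReal.ofReal_coe_nnreal, ← ENNReal.ofReal_ofNat 2,
            ← ENNReal.ofReal_mul (by norm_num)]
          exact ENNReal.ofReal_le_ofReal (hpt _ (g v).2 h1)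
      _ ≤ ∫⁻ v, 2 * ENNReal.ofReal (1 - Real.exp (-(g v : ℝ))) ∂ν := setLIntegral_le_lintegral _ _
      _ = _ := by rw [lintegral_const_mul _ (by fun_prop)]; rfl
  have hmeas : Measurable (Bᶜ.indicator fun v => (g v : ℝ≥0∞)) :=
    hg.coe_nnreal_ennreal.indicator hB.compl
  have h1 : ∀ᵐ ω ∂P₀, ∫⁻ v, Bᶜ.indicator (fun v => (g v : ℝ≥0∞)) v ∂(N ω) < ∞ := by
    refine ae_lt_top ((Measure.measurable_lintegral hmeas).comp hN.measurable) ?_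
    rw [hN.lintegral_lintegral hmeas, lintegral_indicator hB.compl]
    exact hBc
  filter_upwards [h1, hN.ae_setLIntegral_lt_top hg hB hνB] with ω hω1 hω2
  rw [lintegral_indicator hB.compl] at hω1
  rw [linFun, ← lintegral_add_compl _ hB]
  exact ENNReal.add_lt_top.2 ⟨hω2, hω1⟩

lemma integral_exp_neg_mul_apply (hN : IsPoissonRandomMeasure N ν P₀) {B : Set 𝓥}
    (hB : MeasurableSet B) (hνB : ν B ≠ ∞) (c : ℝ) :
    ∫ ω, Real.exp (-(c * (N ω B).toReal)) ∂P₀ =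
      Real.exp (-((ν B).toReal * (1 - Real.exp (-c)))) := by
  have h : ∫ x : ℝ≥0∞, Real.exp (-(c * x.toReal)) ∂(P₀.map fun ω => N ω B) =
      ∫ ω, Real.exp (-(c * (N ω B).toReal)) ∂P₀ :=
    integral_map (hN.measurable_apply hB).aemeasurable (by fun_prop)
  rw [← h, hN.map_apply B hB hνB, integral_map (by fun_prop) (by fun_prop)]
  simp only [ENNReal.toReal_natCast]
  rw [integral_exp_neg_mul_poissonMeasure]
  rfl

lemma integral_exp_neg_sum (hN : IsPoissonRandomMeasure N ν P₀) (k : ℕ) (B : Fin k → Set 𝓥)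
    (hB : ∀ i, MeasurableSet (B i)) (hd : Pairwise (fun i j => Disjoint (B i) (B j)))
    (hνB : ∀ i, ν (B i) ≠ ∞) (c : Fin k → ℝ) :
    ∫ ω, Real.exp (-∑ i, c i * (N ω (B i)).toReal) ∂P₀ =
      Real.exp (-∑ i, (ν (B i)).toReal * (1 - Real.exp (-(c i)))) := by
  rw [← Finset.sum_neg_distrib, Real.exp_sum]
  simp_rw [← Finset.sum_neg_distrib, Real.exp_sum]
  rw [(hN.iIndepFun k B hB hd).integral_fun_prod_comp (𝕜 := ℝ)
    (f := fun i x => Real.exp (-(c i * x.toReal)))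
    (fun i => (hN.measurable_apply (hB i)).aemeasurable) (fun i => by fun_prop)]
  exact Finset.prod_congr rfl fun i _ => hN.integral_exp_neg_mul_apply (hB i) (hνB i) (c i)

/-- The Laplace functional on simple functions supported on a set of finite intensity. -/
lemma integral_exp_neg_simpleFunc [IsProbabilityMeasure P₀] (hN : IsPoissonRandomMeasure N ν P₀)
    (s : SimpleFunc 𝓥 ℝ≥0∞)
    (hs : ∀ v, s v ≠ ∞) (hν : ∀ x ≠ 0, ν (s ⁻¹' {x}) ≠ ∞) :
    ∫ ω, Real.exp (-(∫⁻ v, s v ∂(N ω)).toReal) ∂P₀ =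
      Real.exp (-(∫⁻ v, ENNReal.ofReal (1 - Real.exp (-(s v).toReal)) ∂ν).toReal) := by
  classical
  -- The value `0` is discarded: its level set may have infinite intensity, and it contributes to
  -- neither integral.
  set T : Finset ℝ≥0∞ := s.range.filter (· ≠ 0) with hT
  let e : Fin T.card ≃ T := T.equivFin.symm
  have hTne : ∀ x ∈ T, x ≠ ∞ := by
    intro x hx
    obtain ⟨v, rfl⟩ := SimpleFunc.mem_range.1 (Finset.mem_filter.1 hx).1
    exact hs v
  have hTν : ∀ x ∈ T, ν (s ⁻¹' {x}) ≠ ∞ := fun x hx => hν x (Finset.mem_filter.1 hx).2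
  have hsum : ∀ (F : ℝ≥0∞ → ℝ≥0∞) (m : Measure 𝓥), F 0 = 0 →
      ∫⁻ v, F (s v) ∂m = ∑ x ∈ T, F x * m (s ⁻¹' {x}) := by
    intro F m hF
    have h1 : ∫⁻ v, F (s v) ∂m = (s.map F).lintegral m := by
      rw [← SimpleFunc.lintegral_eq_lintegral]; rfl
    rw [h1, SimpleFunc.map_lintegral, hT, Finset.sum_filter]
    refine Finset.sum_congr rfl fun x _ => ?_
    split_ifs with hx
    · rfl
    · rw [not_not.1 hx, hF, zero_mul]
  have hre : ∀ F : ℝ≥0∞ → ℝ, ∑ i, F (e i) = ∑ x ∈ T, F x := by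
    intro F
    rw [e.sum_comp (fun x : T => F x), Finset.sum_coe_sort T F]
  have key := hN.integral_exp_neg_sum T.card (fun i => s ⁻¹' {(e i : ℝ≥0∞)})
    (fun i => s.measurableSet_preimage _) (fun i j hij => by
      refine Disjoint.preimage _ (disjoint_singleton.2 fun h => hij ?_)
      exact e.injective (Subtype.ext h))
    (fun i => hTν _ (e i).2) (fun i => (e i : ℝ≥0∞).toReal)
  rw [hre (fun x => (ν (s ⁻¹' {x})).toReal * (1 - Real.exp (-x.toReal)))] at key
  have hkey : ∀ ω, ∑ i, (e i : ℝ≥0∞).toReal * (N ω (s ⁻¹' {(e i : ℝ≥0∞)})).toReal =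
      ∑ x ∈ T, x.toReal * (N ω (s ⁻¹' {x})).toReal := fun ω =>
    hre (fun x => x.toReal * (N ω (s ⁻¹' {x})).toReal)
  simp_rw [hkey] at key
  have hfin : ∀ᵐ ω ∂P₀, ∀ x ∈ T, N ω (s ⁻¹' {x}) ≠ ∞ := by
    refine (ae_ball_iff T.countable_toSet).2 fun x hx => ?_
    filter_upwards [hN.ae_exists_nat (s.measurableSet_preimage {x}) (hTν x hx)] with ω hω
    obtain ⟨k, hk⟩ := hω
    rw [hk]
    exact ENNReal.natCast_ne_top k
  have hL : ∫ ω, Real.exp (-(∫⁻ v, s v ∂(N ω)).toReal) ∂P₀ =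
      ∫ ω, Real.exp (-∑ x ∈ T, x.toReal * (N ω (s ⁻¹' {x})).toReal) ∂P₀ := by
    refine integral_congr_ae ?_
    filter_upwards [hfin] with ω hω
    have h2 := hsum id (N ω) rfl
    simp only [id] at h2
    rw [h2, ENNReal.toReal_sum fun x hx => ENNReal.mul_ne_top (hTne x hx) (hω x hx)]
    simp_rw [ENNReal.toReal_mul]
  rw [hL, key]
  congr 2
  have h2 := hsum (fun x => ENNReal.ofReal (1 - Real.exp (-x.toReal))) ν (by simp)
  rw [h2, ENNReal.toReal_sum fun x hx => ENNReal.mul_ne_top ENNReal.ofReal_ne_top (hTν x hx)]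
  refine Finset.sum_congr rfl fun x _ => ?_
  rw [ENNReal.toReal_mul, ENNReal.toReal_ofReal, mul_comm]
  have : Real.exp (-x.toReal) ≤ 1 := Real.exp_le_one_iff.2 (by simp)
  linarith

/-- The Laplace functional of a Poisson random measure. -/
theorem integral_exp_neg_linFun [SigmaFinite ν] [IsProbabilityMeasure P₀]
    (hN : IsPoissonRandomMeasure N ν P₀) {g : 𝓥 → ℝ≥0} (hg : Measurable g)
    (hΛ : Lam ν (fun v => g v) < ∞) :
    ∫ ω, Real.exp (-(linFun (N ω) g).toReal) ∂P₀ = Real.exp (-(Lam ν (fun v => g v)).toReal) := by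
  set G : 𝓥 → ℝ≥0∞ := fun v => (g v : ℝ≥0∞) with hG
  have hGm : Measurable G := hg.coe_nnreal_ennreal
  -- Cutting off to the spanning sets gives the nonzero level sets finite intensity while keeping
  -- the convergence upwards to `g`.
  set s : ℕ → SimpleFunc 𝓥 ℝ≥0∞ := fun m =>
    (SimpleFunc.eapprox G m).restrict (spanningSets ν m) with hs
  have hsapp : ∀ m v, s m v = (spanningSets ν m).indicator (SimpleFunc.eapprox G m) v := fun m v =>
    SimpleFunc.restrict_apply _ (measurableSet_spanningSets ν m) v
  have hslt : ∀ m v, s m v ≠ ∞ := by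
    intro m v
    rw [hsapp]
    by_cases hv : v ∈ spanningSets ν m
    · rw [indicator_of_mem hv]; exact (SimpleFunc.eapprox_lt_top _ _ _).ne
    · rw [indicator_of_notMem hv]; simp
  have hsmono : ∀ v, Monotone fun m => s m v := by
    intro v a b hab
    simp only [hsapp]
    by_cases hv : v ∈ spanningSets ν a
    · rw [indicator_of_mem hv, indicator_of_mem (monotone_spanningSets ν hab hv)]
      exact SimpleFunc.monotone_eapprox G hab v
    · rw [indicator_of_notMem hv]; exact zero_le
  have hstend : ∀ v, Filter.Tendsto (fun m => s m v) Filter.atTop (nhds (G v)) := by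
    intro v
    have h1 : Filter.Tendsto (fun m => SimpleFunc.eapprox G m v) Filter.atTop (nhds (G v)) := by
      rw [← SimpleFunc.iSup_eapprox_apply hGm v]
      exact tendsto_atTop_iSup fun a b hab => SimpleFunc.monotone_eapprox G hab v
    refine h1.congr' ?_
    filter_upwards [Filter.eventually_ge_atTop (spanningSetsIndex ν v)] with m hm
    rw [hsapp, indicator_of_mem]
    exact monotone_spanningSets ν hm (mem_spanningSetsIndex ν v)
  have hsν : ∀ m, ∀ x ≠ 0, ν (s m ⁻¹' {x}) ≠ ∞ := by
    intro m x hx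
    refine measure_ne_top_of_subset (fun v hv => ?_) (measure_spanningSets_lt_top ν m).ne
    by_contra hv'
    rw [mem_preimage, hsapp, indicator_of_notMem hv'] at hv
    exact hx (mem_singleton_iff.1 hv).symm
  have key := fun m => hN.integral_exp_neg_simpleFunc (s m) (hslt m) (hsν m)
  have hL : Filter.Tendsto (fun m => ∫ ω, Real.exp (-(∫⁻ v, s m v ∂(N ω)).toReal) ∂P₀) Filter.atTop
      (nhds (∫ ω, Real.exp (-(linFun (N ω) g).toReal) ∂P₀)) := by
    refine tendsto_integral_of_dominated_convergence (fun _ => 1) (fun m => ?_)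
      (integrable_const 1) (fun m => ?_) ?_
    · have := (Measure.measurable_lintegral (s m).measurable).comp hN.measurable
      exact (Real.measurable_exp.comp this.ennreal_toReal.neg).aestronglyMeasurable
    · refine Filter.Eventually.of_forall fun ω => ?_
      rw [Real.norm_eq_abs, abs_of_pos (Real.exp_pos _)]
      exact Real.exp_le_one_iff.2 (by simp)
    -- Finiteness of `N(g)` is essential here, since `toReal` is discontinuous at `∞`.
    · filter_upwards [hN.ae_linFun_lt_top hg hΛ] with ω hω
      have h1 : Filter.Tendsto (fun m => ∫⁻ v, s m v ∂(N ω)) Filter.atTop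
          (nhds (linFun (N ω) g)) :=
        lintegral_tendsto_of_tendsto_of_monotone (fun m => (s m).measurable.aemeasurable)
          (Filter.Eventually.of_forall hsmono) (Filter.Eventually.of_forall hstend)
      exact (Real.continuous_exp.tendsto _).comp
        ((ENNReal.tendsto_toReal hω.ne).comp h1).neg
  have hR : Filter.Tendsto (fun m => Real.exp (-(∫⁻ v, ENNReal.ofReal
      (1 - Real.exp (-(s m v).toReal)) ∂ν).toReal)) Filter.atTop
      (nhds (Real.exp (-(Lam ν (fun v => g v)).toReal))) := by
    refine (Real.continuous_exp.tendsto _).comp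
      ((ENNReal.tendsto_toReal hΛ.ne).comp ?_).neg
    refine lintegral_tendsto_of_tendsto_of_monotone (fun m => ?_) ?_ ?_
    · have := (s m).measurable.ennreal_toReal
      fun_prop
    · refine Filter.Eventually.of_forall fun v a b hab => ENNReal.ofReal_le_ofReal ?_
      have := ENNReal.toReal_mono (hslt b v) (hsmono v hab)
      have := Real.exp_le_exp.2 (neg_le_neg this)
      linarith
    · refine Filter.Eventually.of_forall fun v => ?_
      have h1 : Filter.Tendsto (fun m => (s m v).toReal) Filter.atTop (nhds (g v : ℝ)) :=
        (ENNReal.tendsto_toReal (by simp [hG])).comp (hstend v)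
      exact (ENNReal.continuous_ofReal.tendsto _).comp
        (tendsto_const_nhds.sub ((Real.continuous_exp.tendsto _).comp h1.neg))
  simp_rw [key] at hL
  exact tendsto_nhds_unique hL hR

end IsPoissonRandomMeasure

/-! ### Set partitions: recursion on the position of `0`. -/

section Recursion

open Classical in
-- Any surjective labelling `c` may index the cells of its kernel, so products over cells can be
-- computed without handling the quotient.
lemma prod_cell_ker {n : ℕ} {T M : Type*} [Fintype T] [CommMonoid M] (c : Fin n → T)
    (hc : Function.Surjective c) (κ : Finset (Fin n) → M) :
    ∏ j : Quotient (Setoid.ker c), κ (cell (Setoid.ker c) j) =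
      ∏ t : T, κ (Finset.univ.filter fun i => c i = t) := by
  refine Fintype.prod_equiv (Setoid.quotientKerEquivOfSurjective c hc) _ _ fun j => ?_
  induction j using Quotient.inductionOn with
  | h i =>
    congr 1
    ext l
    simp only [cell, Finset.mem_filter, Finset.mem_univ, true_and, Quotient.eq]
    rfl

/-- The partition of `{0, …, n}` obtained from a partition `p` of `{1, …, n}` by adding `0` to one
of the cells of `p`, or as a new cell. -/
def insertZero {n : ℕ} (p : Setoid (Fin n)) (o : Option (Quotient p)) : Setoid (Fin (n + 1)) :=
  Setoid.ker (Fin.cases o (fun i => some (Quotient.mk p i)) : Fin (n + 1) → Option (Quotient p))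

lemma insertZero_rel {n : ℕ} (p : Setoid (Fin n)) (o : Option (Quotient p)) (a b : Fin (n + 1)) :
    insertZero p o a b ↔
      (Fin.cases o (fun i => some (Quotient.mk p i)) a : Option (Quotient p)) =
        Fin.cases o (fun i => some (Quotient.mk p i)) b :=
  Iff.rfl

lemma comap_succ_insertZero {n : ℕ} (p : Setoid (Fin n)) (o : Option (Quotient p)) :
    Setoid.comap Fin.succ (insertZero p o) = p := by
  ext i j
  simp only [Setoid.comap_rel, insertZero_rel, Fin.cases_succ, Option.some.injEq, Quotient.eq]

lemma insertZero_zero_succ {n : ℕ} (p : Setoid (Fin n)) (o : Option (Quotient p)) (i : Fin n) :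
    insertZero p o 0 i.succ ↔ o = some (Quotient.mk p i) := by
  simp only [insertZero_rel, Fin.cases_succ, Fin.cases_zero]

/-- Restriction along `Fin.succ` recovers `p`, and `o` is determined by which indices are equivalent
to `0`. -/
lemma insertZero_bijective (n : ℕ) :
    Function.Bijective fun x : (Σ p : Setoid (Fin n), Option (Quotient p)) =>
      insertZero x.1 x.2 := by
  constructor
  · rintro ⟨p, o⟩ ⟨p', o'⟩ h
    replace h : insertZero p o = insertZero p' o' := h
    obtain rfl : p = p' := by
      rw [← comap_succ_insertZero p o, h, comap_succ_insertZero]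
    congr 1
    have h1 : ∀ i, o = some (Quotient.mk p i) ↔ o' = some (Quotient.mk p i) := fun i => by
      rw [← insertZero_zero_succ, h, insertZero_zero_succ]
    rcases o with _ | j
    · rcases o' with _ | j'
      · rfl
      · induction j' using Quotient.inductionOn with
        | h i => exact (h1 i).2 rfl
    · induction j using Quotient.inductionOn with
      | h i => exact ((h1 i).1 rfl).symm
  · intro q
    have hkey : ∀ o : Option (Quotient (Setoid.comap Fin.succ q)),
        (∀ i, o = some (Quotient.mk _ i) ↔ q 0 i.succ) →
        insertZero (Setoid.comap Fin.succ q) o = q := by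
      intro o ho
      ext a b
      induction a using Fin.cases with
      | zero =>
        induction b using Fin.cases with
        | zero => exact iff_of_true (Setoid.refl' _ _) (Setoid.refl' _ _)
        | succ j => rw [insertZero_zero_succ, ho]
      | succ i =>
        induction b using Fin.cases with
        | zero => rw [Setoid.comm' _, Setoid.comm' q, insertZero_zero_succ, ho]
        | succ j =>
          have h := comap_succ_insertZero (Setoid.comap Fin.succ q) o
          exact iff_of_eq (congrArg (fun s : Setoid (Fin n) => s i j) h)
    by_cases h : ∃ i : Fin n, q 0 i.succ
    · obtain ⟨i, hi⟩ := h
      refine ⟨⟨Setoid.comap Fin.succ q, some (Quotient.mk _ i)⟩, hkey _ fun l => ?_⟩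
      rw [Option.some.injEq, Quotient.eq, Setoid.comap_rel]
      exact ⟨fun h => Setoid.trans' _ hi h, fun h => Setoid.trans' _ (Setoid.symm' _ hi) h⟩
    · refine ⟨⟨Setoid.comap Fin.succ q, none⟩, hkey _ fun l => ?_⟩
      exact iff_of_false (by simp) fun hl => h ⟨l, hl⟩

open Classical in
lemma prod_cell_insertZero_none {n : ℕ} {M : Type*} [CommMonoid M] (p : Setoid (Fin n))
    (κ : Finset (Fin (n + 1)) → M) :
    ∏ j : Quotient (insertZero p none), κ (cell _ j) =
      κ {0} * ∏ j : Quotient p, κ ((cell p j).map (Fin.succEmb n)) := by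
  unfold insertZero
  rw [prod_cell_ker _ _ κ, Fintype.prod_option]
  · congr 1
    · congr 1
      ext i
      induction i using Fin.cases <;> simp
    · refine Finset.prod_congr rfl fun j _ => ?_
      congr 1
      ext i
      induction i using Fin.cases <;> simp [cell]
  · rintro (_ | j)
    · exact ⟨0, rfl⟩
    · induction j using Quotient.inductionOn with
      | h i => exact ⟨i.succ, rfl⟩

open Classical in
lemma prod_cell_insertZero_some {n : ℕ} {M : Type*} [CommMonoid M] (p : Setoid (Fin n))
    (j₀ : Quotient p) (κ : Finset (Fin (n + 1)) → M) :
    ∏ j : Quotient (insertZero p (some j₀)), κ (cell _ j) =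
      κ (insert 0 ((cell p j₀).map (Fin.succEmb n))) *
        ∏ j ∈ Finset.univ.erase j₀, κ ((cell p j).map (Fin.succEmb n)) := by
  -- Here the label `none` is not attained; relabelling by `Quotient p` restores surjectivity.
  have h : insertZero p (some j₀) = Setoid.ker (Fin.cases j₀ (Quotient.mk p) :
      Fin (n + 1) → Quotient p) := by
    ext a b
    rw [insertZero_rel, Setoid.ker_def]
    induction a using Fin.cases <;> induction b using Fin.cases <;> simp
  rw [h, prod_cell_ker _ _ κ, ← Finset.mul_prod_erase _ _ (Finset.mem_univ j₀)]
  · congr 1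
    · congr 1
      ext i
      induction i using Fin.cases <;> simp [cell]
    · refine Finset.prod_congr rfl fun j hj => ?_
      congr 1
      ext i
      have := (Finset.mem_erase.1 hj).1.symm
      induction i using Fin.cases <;> simp [cell, this]
  · intro j
    induction j using Quotient.inductionOn with
    | h i => exact ⟨i.succ, rfl⟩

open Classical in
/-- The recursion for sums over partitions, according to the position of `0`. -/
lemma sum_partition_succ {n : ℕ} {R : Type*} [CommSemiring R] (κ : Finset (Fin (n + 1)) → R) :
    ∑ q : Setoid (Fin (n + 1)), ∏ j : Quotient q, κ (cell q j) =
      ∑ p : Setoid (Fin n), (κ {0} * ∏ j : Quotient p, κ ((cell p j).map (Fin.succEmb n)) +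
        ∑ j₀ : Quotient p, κ (insert 0 ((cell p j₀).map (Fin.succEmb n))) *
          ∏ j ∈ Finset.univ.erase j₀, κ ((cell p j).map (Fin.succEmb n))) := by
  rw [← (insertZero_bijective n).sum_comp fun q => ∏ j : Quotient q, κ (cell q j),
    Fintype.sum_sigma]
  refine Finset.sum_congr rfl fun p _ => ?_
  rw [Fintype.sum_option, prod_cell_insertZero_none]
  simp_rw [prod_cell_insertZero_some]

lemma sum_partition_zero {R : Type*} [CommSemiring R] (κ : Finset (Fin 0) → R) :
    ∑ q : Setoid (Fin 0), ∏ j : Quotient q, κ (cell q j) = 1 := by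
  have : Subsingleton (Setoid (Fin 0)) := ⟨fun a b => Setoid.ext fun i => i.elim0⟩
  rw [Fintype.sum_subsingleton _ (⊥ : Setoid (Fin 0))]
  have : IsEmpty (Quotient (⊥ : Setoid (Fin 0))) := ⟨fun j => (Quotient.exists_rep j).choose.elim0⟩
  exact Fintype.prod_empty _

lemma cell_nonempty {n : ℕ} (p : Setoid (Fin n)) (j : Quotient p) : (cell p j).Nonempty := by
  induction j using Quotient.inductionOn with
  | h i => exact ⟨i, by simp [cell]⟩

end Recursion

/-! ### Right derivatives at `0` of exponential integrals. -/

section Derivative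

variable {X : Type*} [MeasurableSpace X] {μ : Measure X}

/-- Dominated convergence for the slopes, using `0 ≤ t⁻¹ (1 - e^{-t h}) ≤ h` for `t > 0`. Only `F h`
has to be integrable, not `F`; this covers `F = e^{-g}` under an infinite `ν`. -/
lemma hasDerivWithinAt_integral_mul_one_sub_exp {F h : X → ℝ} (hF : Measurable F)
    (hh : Measurable h) (hpos : ∀ᵐ x ∂μ, 0 ≤ h x) (hint : Integrable (fun x => F x * h x) μ) :
    HasDerivWithinAt (fun t : ℝ => ∫ x, F x * (1 - Real.exp (-(t * h x))) ∂μ)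
      (∫ x, F x * h x ∂μ) (Ici 0) 0 := by
  rw [← hasDerivWithinAt_Ioi_iff_Ici, hasDerivWithinAt_iff_tendsto_slope' (by simp)]
  have hslope : ∀ t : ℝ, slope (fun t : ℝ => ∫ x, F x * (1 - Real.exp (-(t * h x))) ∂μ) 0 t =
      ∫ x, F x * (t⁻¹ * (1 - Real.exp (-(t * h x)))) ∂μ := by
    intro t
    simp only [slope_def_module, sub_zero, zero_mul, neg_zero, Real.exp_zero, sub_self, mul_zero,
      integral_zero, smul_eq_mul]
    rw [← integral_const_mul]
    congr with x
    ring
  rw [funext hslope]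
  refine tendsto_integral_filter_of_dominated_convergence (fun x => ‖F x * h x‖)
    (Filter.Eventually.of_forall fun t => by fun_prop) ?_ hint.norm ?_
  · filter_upwards [self_mem_nhdsWithin] with t ht
    filter_upwards [hpos] with x hx
    have ht' : 0 < t := ht
    rw [norm_mul, norm_mul (F x) (h x)]
    refine mul_le_mul_of_nonneg_left ?_ (norm_nonneg (F x))
    have h1 : Real.exp (-(t * h x)) ≤ 1 := Real.exp_le_one_iff.2 (by nlinarith)
    have h2 := Real.one_sub_le_exp_neg (t * h x)
    rw [Real.norm_of_nonneg (mul_nonneg (inv_nonneg.2 ht'.le) (by linarith)),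
      Real.norm_of_nonneg hx, inv_mul_le_iff₀ ht']
    linarith
  · refine Filter.Eventually.of_forall fun x => Filter.Tendsto.const_mul _ ?_
    have hd : HasDerivAt (fun t : ℝ => 1 - Real.exp (-(t * h x))) (h x) 0 := by
      have := (((hasDerivAt_id (0 : ℝ)).mul_const (h x)).fun_neg.exp).const_sub 1
      simpa using this
    have := (hasDerivAt_iff_tendsto_slope.1 hd).mono_left
      (nhdsWithin_mono 0 (fun t (ht : t ∈ Ioi (0 : ℝ)) => ne_of_gt ht))
    refine this.congr fun t => ?_
    simp [slope_def_module]

lemma hasDerivWithinAt_integral_mul_exp {F h : X → ℝ} (hF : Measurable F)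
    (hh : Measurable h) (hpos : ∀ᵐ x ∂μ, 0 ≤ h x) (hFint : Integrable F μ)
    (hint : Integrable (fun x => F x * h x) μ) :
    HasDerivWithinAt (fun t : ℝ => ∫ x, F x * Real.exp (-(t * h x)) ∂μ)
      (-∫ x, F x * h x ∂μ) (Ici 0) 0 := by
  refine ((hasDerivWithinAt_integral_mul_one_sub_exp hF hh hpos hint).const_sub
    (∫ x, F x ∂μ)).congr (fun t ht => ?_) (by simp)
  have ht' : (0 : ℝ) ≤ t := ht
  have hi : Integrable (fun x => F x * (1 - Real.exp (-(t * h x)))) μ := by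
    refine hFint.norm.mono' (by fun_prop) ?_
    filter_upwards [hpos] with x hx
    have h1 : Real.exp (-(t * h x)) ≤ 1 := Real.exp_le_one_iff.2 (by nlinarith)
    have h2 := Real.exp_pos (-(t * h x))
    rw [norm_mul]
    refine mul_le_of_le_one_right (norm_nonneg _) ?_
    rw [Real.norm_of_nonneg (by linarith)]
    linarith
  rw [← integral_sub hFint hi]
  congr with x
  ring

end Derivative

/-- From the series of `e^x` only the terms of order `0` and `k` are kept. The bound converts
finiteness of `Λ` into integrability of products over a cell; `k ≠ 0` reflects that cells are
nonempty. -/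
lemma pow_mul_exp_neg_le {x : ℝ} (hx : 0 ≤ x) {k : ℕ} (hk : k ≠ 0) :
    x ^ k * Real.exp (-x) ≤ k.factorial * (1 - Real.exp (-x)) := by
  have h1 : 1 + x ^ k / k.factorial ≤ Real.exp x := by
    have h := Real.sum_le_exp_of_nonneg hx (k + 1)
    have h2 : ∑ i ∈ ({0, k} : Finset ℕ), x ^ i / (i.factorial : ℝ) ≤
        ∑ i ∈ Finset.range (k + 1), x ^ i / (i.factorial : ℝ) := by
      refine Finset.sum_le_sum_of_subset_of_nonneg (fun i hi => ?_) fun i _ _ => by positivity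
      simp only [Finset.mem_insert, Finset.mem_singleton] at hi
      simp only [Finset.mem_range]
      omega
    rw [Finset.sum_pair hk.symm] at h2
    simp only [pow_zero, Nat.factorial_zero, Nat.cast_one, div_one] at h2
    linarith
  have hf : (0 : ℝ) < k.factorial := by positivity
  have h2 : x ^ k ≤ k.factorial * (Real.exp x - 1) := by
    have := (div_le_iff₀ hf).1 (le_sub_iff_add_le'.2 h1)
    linarith
  calc x ^ k * Real.exp (-x) ≤ k.factorial * (Real.exp x - 1) * Real.exp (-x) :=
        mul_le_mul_of_nonneg_right h2 (Real.exp_pos _).le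
    _ = k.factorial * (Real.exp x * Real.exp (-x) - Real.exp (-x)) := by ring
    _ = _ := by rw [← Real.exp_add]; simp

/-! ### Exponentially weighted mixed moments of a Poisson random measure. -/

section Moments

variable {𝓥 : Type*} [MeasurableSpace 𝓥]

/-- The integral `∫ [∏_{i ∈ C} h_i] e^{-g} dν`. -/
def cellIntegral {n : ℕ} (ν : Measure 𝓥) (g : 𝓥 → ℝ≥0) (h : Fin n → 𝓥 → ℝ≥0)
    (C : Finset (Fin n)) : ℝ :=
  ∫ v, (∏ i ∈ C, (h i v : ℝ)) * Real.exp (-(g v : ℝ)) ∂ν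

variable {ν : Measure 𝓥}

lemma Lam_mono {g g' : 𝓥 → ℝ} (h : ∀ v, g v ≤ g' v) : Lam ν g ≤ Lam ν g' := by
  refine lintegral_mono fun v => ENNReal.ofReal_le_ofReal ?_
  have := Real.exp_le_exp.2 (neg_le_neg (h v))
  linarith

lemma one_sub_exp_neg_nonneg {x : ℝ} (hx : 0 ≤ x) : 0 ≤ 1 - Real.exp (-x) := by
  have : Real.exp (-x) ≤ 1 := Real.exp_le_one_iff.2 (by simpa)
  linarith

lemma integrable_one_sub_exp_neg {g : 𝓥 → ℝ≥0} (hg : Measurable g)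
    (hΛ : Lam ν (fun v => g v) < ∞) : Integrable (fun v => 1 - Real.exp (-(g v : ℝ))) ν := by
  refine ⟨by fun_prop, ?_⟩
  rw [hasFiniteIntegral_iff_ofReal (Filter.Eventually.of_forall fun v =>
    one_sub_exp_neg_nonneg (g v).coe_nonneg)]
  exact hΛ

lemma toReal_Lam {g : 𝓥 → ℝ≥0} (hg : Measurable g) :
    (Lam ν (fun v => g v)).toReal = ∫ v, (1 - Real.exp (-(g v : ℝ))) ∂ν := by
  rw [integral_eq_lintegral_of_nonneg_ae (Filter.Eventually.of_forall fun v =>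
    one_sub_exp_neg_nonneg (g v).coe_nonneg) (by fun_prop)]
  rfl

/-- The integrand is at most `K^|C| |C|! (1 - e^{-g})`. The domination `h i ≤ K g` holds for `g =
Ω_n` with positive weights and survives enlarging `g`, as the induction below requires. -/
lemma integrable_prod_mul_exp_neg {n : ℕ} {g : 𝓥 → ℝ≥0} {h : Fin n → 𝓥 → ℝ≥0} {K : ℝ≥0}
    (hg : Measurable g) (hh : ∀ i, Measurable (h i)) (hK : ∀ i v, h i v ≤ K * g v)
    (hΛ : Lam ν (fun v => g v) < ∞) {C : Finset (Fin n)} (hC : C.Nonempty) :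
    Integrable (fun v => (∏ i ∈ C, (h i v : ℝ)) * Real.exp (-(g v : ℝ))) ν := by
  have hm : Measurable fun v => (∏ i ∈ C, (h i v : ℝ)) * Real.exp (-(g v : ℝ)) :=
    (Finset.measurable_fun_prod _ fun i _ => (hh i).coe_nnreal_real).mul (by fun_prop)
  refine (((integrable_one_sub_exp_neg hg hΛ).const_mul (C.card.factorial : ℝ)).const_mul
    ((K : ℝ) ^ C.card)).mono' hm.aestronglyMeasurable (Filter.Eventually.of_forall fun v => ?_)
  have hK' : ∀ i ∈ C, (h i v : ℝ) ≤ K * g v := fun i _ => by exact_mod_cast hK i v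
  rw [Real.norm_of_nonneg (mul_nonneg (Finset.prod_nonneg fun i _ => (h i v).coe_nonneg)
    (Real.exp_pos _).le)]
  calc (∏ i ∈ C, (h i v : ℝ)) * Real.exp (-(g v : ℝ))
      ≤ (K * g v) ^ C.card * Real.exp (-(g v : ℝ)) := by
        refine mul_le_mul_of_nonneg_right ?_ (Real.exp_pos _).le
        rw [← Finset.prod_const]
        exact Finset.prod_le_prod (fun i _ => (h i v).coe_nonneg) hK'
    _ = K ^ C.card * ((g v : ℝ) ^ C.card * Real.exp (-(g v : ℝ))) := by rw [mul_pow, mul_assoc]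
    _ ≤ _ := mul_le_mul_of_nonneg_left
        (pow_mul_exp_neg_le (g v).coe_nonneg (Finset.card_pos.2 hC).ne') (by positivity)

variable {Ω₀ : Type*} [MeasurableSpace Ω₀] {N : Ω₀ → Measure 𝓥} {P₀ : Measure Ω₀}

lemma linFun_add_mul (m : Measure 𝓥) {g h : 𝓥 → ℝ≥0} (hg : Measurable g) (hh : Measurable h)
    (t : ℝ≥0) : linFun m (fun v => g v + t * h v) = linFun m g + t * linFun m h := by
  unfold linFun
  push_cast
  rw [lintegral_add_left hg.coe_nnreal_ennreal, lintegral_const_mul _ hh.coe_nnreal_ennreal]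

lemma linFun_le_mul (m : Measure 𝓥) {g h : 𝓥 → ℝ≥0} (hg : Measurable g) {K : ℝ≥0}
    (hK : ∀ v, h v ≤ K * g v) : linFun m h ≤ K * linFun m g := by
  unfold linFun
  rw [← lintegral_const_mul _ hg.coe_nnreal_ennreal]
  refine lintegral_mono fun v => ?_
  rw [← ENNReal.coe_mul]
  exact ENNReal.coe_le_coe.2 (hK v)

/-- With `x = N(g)`, the integrand is at most `K^n x^n e^{-x} ≤ K^n n!`, a constant. -/
lemma IsPoissonRandomMeasure.integrable_exp_neg_mul_prod [SigmaFinite ν] [IsProbabilityMeasure P₀]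
    (hN : IsPoissonRandomMeasure N ν P₀) {n : ℕ} {g : 𝓥 → ℝ≥0} {h : Fin n → 𝓥 → ℝ≥0} {K : ℝ≥0}
    (hg : Measurable g) (hh : ∀ i, Measurable (h i)) (hK : ∀ i v, h i v ≤ K * g v)
    (hΛ : Lam ν (fun v => g v) < ∞) :
    Integrable (fun ω => Real.exp (-(linFun (N ω) g).toReal) *
      ∏ i, (linFun (N ω) (h i)).toReal) P₀ := by
  have hm : Measurable fun ω => Real.exp (-(linFun (N ω) g).toReal) *
      ∏ i, (linFun (N ω) (h i)).toReal := by
    have h1 := (hN.measurable_linFun hg).ennreal_toReal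
    have h2 := fun i => (hN.measurable_linFun (hh i)).ennreal_toReal
    exact (by fun_prop : Measurable fun ω => Real.exp (-(linFun (N ω) g).toReal)).mul
      (Finset.measurable_fun_prod _ fun i _ => h2 i)
  refine (integrable_const ((K : ℝ) ^ n * n.factorial)).mono' hm.aestronglyMeasurable ?_
  filter_upwards [hN.ae_linFun_lt_top hg hΛ] with ω hω
  have hle : ∀ i, (linFun (N ω) (h i)).toReal ≤ K * (linFun (N ω) g).toReal := by
    intro i
    have := ENNReal.toReal_mono (ENNReal.mul_ne_top ENNReal.coe_ne_top hω.ne)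
      (linFun_le_mul (N ω) hg (hK i))
    rwa [ENNReal.toReal_mul, ENNReal.coe_toReal] at this
  set x := (linFun (N ω) g).toReal with hx
  have hx0 : 0 ≤ x := ENNReal.toReal_nonneg
  rw [Real.norm_of_nonneg (mul_nonneg (Real.exp_pos _).le
    (Finset.prod_nonneg fun i _ => ENNReal.toReal_nonneg))]
  have hpow : x ^ n ≤ n.factorial * Real.exp x := by
    have := Real.pow_div_factorial_le_exp x hx0 n
    rw [div_le_iff₀ (by positivity)] at this
    linarith
  calc Real.exp (-x) * ∏ i, (linFun (N ω) (h i)).toReal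
      ≤ Real.exp (-x) * (K * x) ^ n := by
        refine mul_le_mul_of_nonneg_left ?_ (Real.exp_pos _).le
        calc _ ≤ ∏ _i : Fin n, (K * x) :=
              Finset.prod_le_prod (fun i _ => ENNReal.toReal_nonneg) fun i _ => hle i
          _ = _ := by simp
    _ = Real.exp (-x) * K ^ n * x ^ n := by rw [mul_pow, mul_assoc]
    _ ≤ Real.exp (-x) * K ^ n * (n.factorial * Real.exp x) :=
        mul_le_mul_of_nonneg_left hpow (by positivity)
    _ = K ^ n * n.factorial * (Real.exp (-x) * Real.exp x) := by ring
    _ = _ := by rw [← Real.exp_add]; simp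

open Classical in
/-- The exponentially weighted mixed moments of a Poisson random measure. -/
theorem IsPoissonRandomMeasure.integral_exp_neg_mul_prod [SigmaFinite ν] [IsProbabilityMeasure P₀]
    (hN : IsPoissonRandomMeasure N ν P₀) {n : ℕ} {g : 𝓥 → ℝ≥0} {h : Fin n → 𝓥 → ℝ≥0} {K : ℝ≥0}
    (hg : Measurable g) (hh : ∀ i, Measurable (h i)) (hK : ∀ i v, h i v ≤ K * g v)
    (hΛ : ∀ c : ℝ≥0, Lam ν (fun v => ((c * g v : ℝ≥0) : ℝ)) < ∞) :
    ∫ ω, Real.exp (-(linFun (N ω) g).toReal) * ∏ i, (linFun (N ω) (h i)).toReal ∂P₀ =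
      Real.exp (-(Lam ν (fun v => g v)).toReal) *
        ∑ p : Setoid (Fin n), ∏ j : Quotient p, cellIntegral ν g h (cell p j) := by
  induction n generalizing g K with
  | zero =>
    rw [sum_partition_zero, mul_one]
    simp only [Finset.univ_eq_empty, Finset.prod_empty, mul_one]
    refine hN.integral_exp_neg_linFun hg ?_
    simpa using hΛ 1
  | succ n ih =>
    have hΛ1 : Lam ν (fun v => g v) < ∞ := by simpa using hΛ 1
    -- The perturbation to be differentiated. Only `t ≥ 0` matters, hence the one-sided derivatives.
    set gt : ℝ → 𝓥 → ℝ≥0 := fun t v => g v + t.toNNReal * h 0 v with hgt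
    have hgtm : ∀ t, Measurable (gt t) := fun t => hg.add ((hh 0).const_mul _)
    have hgt_coe : ∀ t, 0 ≤ t → ∀ v, (gt t v : ℝ) = g v + t * h 0 v := by
      intro t ht v
      simp [hgt, ht]
    have hgtle : ∀ t v, gt t v ≤ (1 + t.toNNReal * K) * g v := by
      intro t v
      calc g v + t.toNNReal * h 0 v ≤ g v + t.toNNReal * (K * g v) := by gcongr; exact hK 0 v
        _ = _ := by ring
    -- The perturbed function is dominated by a multiple of `g`; this is why `Λ` is assumed finite
    -- at all multiples.
    have hgtΛ : ∀ t, ∀ c : ℝ≥0, Lam ν (fun v => ((c * gt t v : ℝ≥0) : ℝ)) < ∞ := by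
      intro t c
      refine (Lam_mono fun v => ?_).trans_lt (hΛ (c * (1 + t.toNNReal * K)))
      rw [mul_assoc]
      exact_mod_cast mul_le_mul_of_nonneg_left (hgtle t v) zero_le
    have hgtK : ∀ t, ∀ i : Fin n, ∀ v, h i.succ v ≤ K * gt t v := fun t i v =>
      (hK i.succ v).trans (mul_le_mul_of_nonneg_left le_self_add zero_le)
    have hIH := fun t => ih (g := gt t) (h := fun i => h i.succ) (hgtm t) (fun i => hh i.succ)
      (hgtK t) (hgtΛ t)
    set F : Ω₀ → ℝ := fun ω => Real.exp (-(linFun (N ω) g).toReal) *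
      ∏ i : Fin n, (linFun (N ω) (h i.succ)).toReal with hF
    have hFm : Measurable F := by
      have h1 := (hN.measurable_linFun hg).ennreal_toReal
      have h2 := fun i => (hN.measurable_linFun (hh i)).ennreal_toReal
      exact (by fun_prop : Measurable fun ω => Real.exp (-(linFun (N ω) g).toReal)).mul
        (Finset.measurable_fun_prod _ fun i _ => h2 _)
    have hFint : Integrable F P₀ :=
      hN.integrable_exp_neg_mul_prod hg (fun i => hh i.succ) (fun i => hK i.succ) hΛ1
    have hprod : ∀ ω, F ω * (linFun (N ω) (h 0)).toReal =
        Real.exp (-(linFun (N ω) g).toReal) * ∏ i, (linFun (N ω) (h i)).toReal := by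
      intro ω
      rw [Fin.prod_univ_succ, hF]
      ring
    have hFint' : Integrable (fun ω => F ω * (linFun (N ω) (h 0)).toReal) P₀ := by
      simp_rw [hprod]
      exact hN.integrable_exp_neg_mul_prod hg hh hK hΛ1
    have hleft : HasDerivWithinAt (fun t : ℝ => ∫ ω, Real.exp (-(linFun (N ω) (gt t)).toReal) *
        ∏ i : Fin n, (linFun (N ω) (h i.succ)).toReal ∂P₀)
        (-∫ ω, F ω * (linFun (N ω) (h 0)).toReal ∂P₀) (Ici 0) 0 := by
      have hcongr : ∀ t, 0 ≤ t → ∫ ω, Real.exp (-(linFun (N ω) (gt t)).toReal) *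
          ∏ i : Fin n, (linFun (N ω) (h i.succ)).toReal ∂P₀ =
          ∫ ω, F ω * Real.exp (-(t * (linFun (N ω) (h 0)).toReal)) ∂P₀ := by
        intro t ht
        refine integral_congr_ae ?_
        filter_upwards [hN.ae_linFun_lt_top hg hΛ1] with ω hω
        have hω0 : linFun (N ω) (h 0) ≠ ∞ := ne_top_of_le_ne_top
          (ENNReal.mul_ne_top ENNReal.coe_ne_top hω.ne) (linFun_le_mul (N ω) hg (hK 0))
        rw [hgt, linFun_add_mul _ hg (hh 0), ENNReal.toReal_add hω.ne
          (ENNReal.mul_ne_top ENNReal.coe_ne_top hω0), ENNReal.toReal_mul, ENNReal.coe_toReal,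
          Real.coe_toNNReal _ ht, neg_add, Real.exp_add, hF]
        ring
      exact (hasDerivWithinAt_integral_mul_exp hFm (hN.measurable_linFun (hh 0)).ennreal_toReal
        (Filter.Eventually.of_forall fun ω => ENNReal.toReal_nonneg) hFint hFint').congr
        (fun t ht => hcongr t ht) (hcongr 0 le_rfl)
    -- Differentiating the factor of a cell brings down `-h_0`, which adjoins `0` to that cell.
    have hκ : ∀ C : Finset (Fin n), C.Nonempty →
        HasDerivWithinAt (fun t : ℝ => cellIntegral ν (gt t) (fun i => h i.succ) C)
          (-cellIntegral ν g h (insert 0 (C.map (Fin.succEmb n)))) (Ici 0) 0 := by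
      intro C hC
      have hcongr : ∀ t, 0 ≤ t → cellIntegral ν (gt t) (fun i => h i.succ) C =
          ∫ v, ((∏ i ∈ C, (h i.succ v : ℝ)) * Real.exp (-(g v : ℝ))) *
            Real.exp (-(t * (h 0 v : ℝ))) ∂ν := by
        intro t ht
        unfold cellIntegral
        congr with v
        rw [hgt_coe t ht, neg_add, Real.exp_add, mul_assoc]
      have hins : ∀ v, (∏ i ∈ insert 0 (C.map (Fin.succEmb n)), (h i v : ℝ)) *
          Real.exp (-(g v : ℝ)) =
          ((∏ i ∈ C, (h i.succ v : ℝ)) * Real.exp (-(g v : ℝ))) * (h 0 v : ℝ) := by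
        intro v
        rw [Finset.prod_insert (by simp), Finset.prod_map]
        simp only [Fin.coe_succEmb]
        ring
      have hi := integrable_prod_mul_exp_neg hg hh hK hΛ1
        (Finset.insert_nonempty 0 (C.map (Fin.succEmb n)))
      unfold cellIntegral at hcongr ⊢
      simp_rw [hins] at hi ⊢
      refine (hasDerivWithinAt_integral_mul_exp ?_ (hh 0).coe_nnreal_real
        (Filter.Eventually.of_forall fun v => (h 0 v).coe_nonneg)
        (integrable_prod_mul_exp_neg hg (fun i => hh i.succ) (fun i => hK i.succ) hΛ1 hC) hi).congr
        (fun t ht => hcongr t ht) (hcongr 0 le_rfl)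
      exact (Finset.measurable_fun_prod _ fun i _ => (hh i.succ).coe_nnreal_real).mul (by fun_prop)
    have hκ0 : ∀ C : Finset (Fin n), cellIntegral ν (gt 0) (fun i => h i.succ) C =
        cellIntegral ν g h (C.map (Fin.succEmb n)) := by
      intro C
      unfold cellIntegral
      congr with v
      rw [Finset.prod_map, hgt_coe 0 le_rfl, zero_mul, add_zero]
      rfl
    have hΛd : HasDerivWithinAt (fun t : ℝ => Real.exp (-(Lam ν (fun v => gt t v)).toReal))
        (Real.exp (-(Lam ν (fun v => g v)).toReal) * -cellIntegral ν g h {0}) (Ici 0) 0 := by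
      have hint0 : Integrable (fun v => Real.exp (-(g v : ℝ)) * (h 0 v : ℝ)) ν := by
        have := integrable_prod_mul_exp_neg hg hh hK hΛ1 (Finset.singleton_nonempty 0)
        simp only [Finset.prod_singleton] at this
        simpa only [mul_comm] using this
      have hd := hasDerivWithinAt_integral_mul_one_sub_exp
        (F := fun v => Real.exp (-(g v : ℝ))) (by fun_prop) (hh 0).coe_nnreal_real
        (Filter.Eventually.of_forall fun v => (h 0 v).coe_nonneg) hint0
      -- The increment of `Λ` is `∫ e^{-g} (1 - e^{-t h_0}) dν`; its derivative `∫ h_0 e^{-g} dν` is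
      -- the factor of the new cell `{0}`.
      have hcongr : ∀ t, 0 ≤ t → (Lam ν (fun v => gt t v)).toReal =
          (Lam ν (fun v => g v)).toReal +
            ∫ v, Real.exp (-(g v : ℝ)) * (1 - Real.exp (-(t * (h 0 v : ℝ)))) ∂ν := by
        intro t ht
        have hpt : ∀ v, Real.exp (-(g v : ℝ)) * (1 - Real.exp (-(t * (h 0 v : ℝ)))) =
            (1 - Real.exp (-(gt t v : ℝ))) - (1 - Real.exp (-(g v : ℝ))) := by
          intro v
          rw [hgt_coe t ht, neg_add, Real.exp_add]
          ring
        simp_rw [hpt]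
        rw [integral_sub (integrable_one_sub_exp_neg (hgtm t) (by simpa using hgtΛ t 1))
          (integrable_one_sub_exp_neg hg hΛ1), toReal_Lam (hgtm t), toReal_Lam hg]
        ring
      have h2 := ((hd.const_add (Lam ν (fun v => g v)).toReal).congr (fun t ht => hcongr t ht)
        (hcongr 0 le_rfl)).neg.exp
      have h0 : gt 0 = g := by ext v; simp [hgt]
      rw [Pi.neg_apply, h0] at h2
      convert! h2 using 3
      unfold cellIntegral
      simp only [Finset.prod_singleton]
      simp only [mul_comm]
    have hright : HasDerivWithinAt (fun t : ℝ => Real.exp (-(Lam ν (fun v => gt t v)).toReal) *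
        ∑ p : Setoid (Fin n), ∏ j : Quotient p,
          cellIntegral ν (gt t) (fun i => h i.succ) (cell p j)) _ (Ici 0) 0 :=
      hΛd.mul (HasDerivWithinAt.fun_sum fun p _ =>
        HasDerivWithinAt.fun_finsetProd fun j _ => hκ _ (cell_nonempty p j))
    -- The induction hypothesis identifies the two functions on `[0,∞)`, so their right derivatives
    -- at `0` agree.
    have huniq := (uniqueDiffOn_Ici (0 : ℝ) 0 self_mem_Ici).eq_deriv _ hleft
      (hright.congr (fun t _ => hIH t) (hIH 0))
    simp_rw [hprod] at huniq
    rw [neg_eq_iff_eq_neg.1 huniq, sum_partition_succ]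
    have h0 : gt 0 = g := by ext v; simp [hgt]
    simp_rw [hκ0, smul_eq_mul, h0]
    rw [Finset.sum_add_distrib, ← Finset.mul_sum]
    simp only [mul_neg, Finset.sum_neg_distrib]
    simp_rw [mul_comm (∏ j ∈ _, _)]
    ring

end Moments

/-! ### Finite product measures. -/

section Pi

variable {𝓥 : Type*} [MeasurableSpace 𝓥]

lemma lintegral_pi_prod {n : ℕ} (m : Fin n → Measure 𝓥) [∀ i, SigmaFinite (m i)]
    {F : Fin n → 𝓥 → ℝ≥0∞} (hF : ∀ i, Measurable (F i)) :
    ∫⁻ v, ∏ i, F i (v i) ∂(Measure.pi m) = ∏ i, ∫⁻ x, F i x ∂(m i) := by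
  induction n with
  | zero => simp
  | succ n ih =>
    have hmp := measurePreserving_piFinSuccAbove m 0
    have h1 : ∀ v : Fin (n + 1) → 𝓥, ∏ i, F i (v i) =
        (fun z : 𝓥 × (Fin n → 𝓥) => F 0 z.1 * ∏ i : Fin n, F i.succ (z.2 i))
          (MeasurableEquiv.piFinSuccAbove (fun _ => 𝓥) 0 v) := by
      intro v
      rw [Fin.prod_univ_succ]
      rfl
    have hm2 : Measurable fun u : Fin n → 𝓥 => ∏ i : Fin n, F i.succ (u i) :=
      Finset.measurable_fun_prod _ fun i _ => (hF i.succ).comp (measurable_pi_apply i)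
    simp_rw [h1]
    rw [hmp.lintegral_comp (f := fun z : 𝓥 × (Fin n → 𝓥) => F 0 z.1 * ∏ i : Fin n, F i.succ (z.2 i))
      (((hF 0).comp measurable_fst).mul (hm2.comp measurable_snd)),
      lintegral_prod_mul (hF 0).aemeasurable hm2.aemeasurable, Fin.prod_univ_succ]
    congr 1
    exact ih (fun i => m ((0 : Fin (n + 1)).succAbove i)) fun i => hF i.succ

/-- The pair of coordinates has the product law, and by Fubini the diagonal has mass `∫ m_j {x}
m_i(dx) = 0`. -/
lemma pi_eval_eq_eval_null {ι : Type*} [Fintype ι] [MeasurableEq 𝓥] [MeasurableSingletonClass 𝓥]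
    (m : ι → Measure 𝓥)
    [∀ i, IsProbabilityMeasure (m i)] [∀ i, NullSingletonClass (m i)] {i j : ι} (hij : i ≠ j) :
    Measure.pi m {u | u i = u j} = 0 := by
  have hind : IndepFun (fun u : ι → 𝓥 => u i) (fun u => u j) (Measure.pi m) :=
    (iIndepFun_pi (μ := m) (X := fun _ => id) (fun _ => aemeasurable_id)).indepFun hij
  have hmap := (indepFun_iff_map_prod_eq_prod_map_map (measurable_pi_apply i).aemeasurable
    (measurable_pi_apply j).aemeasurable).1 hind
  have hi : (Measure.pi m).map (fun u => u i) = m i := (measurePreserving_eval m i).map_eq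
  have hj : (Measure.pi m).map (fun u => u j) = m j := (measurePreserving_eval m j).map_eq
  rw [hi, hj] at hmap
  have hd : MeasurableSet {z : 𝓥 × 𝓥 | z.1 = z.2} := measurableSet_diagonal
  have h := Measure.map_apply (μ := Measure.pi m) ((measurable_pi_apply i).prodMk
    (measurable_pi_apply j)) hd
  rw [hmap, Measure.prod_apply hd] at h
  refine (h.symm.trans ?_)
  rw [lintegral_eq_zero_iff (measurable_measure_prodMk_left hd)]
  refine Filter.Eventually.of_forall fun x => ?_
  have : Prod.mk x ⁻¹' {z : 𝓥 × 𝓥 | z.1 = z.2} = {x} := by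
    ext y; simp [eq_comm]
  simp [this]

end Pi

/-! ### The partition generated by ties. -/

section Ties

variable {n : ℕ} {𝓥 : Type*} [MeasurableSpace 𝓥]

lemma measurable_tiePartition [MeasurableEq 𝓥] :
    Measurable (tiePartition : (Fin n → 𝓥) → Setoid (Fin n)) := by
  refine measurable_to_countable' fun p => ?_
  have : tiePartition ⁻¹' {p} = ⋂ i : Fin n, ⋂ j : Fin n, {v : Fin n → 𝓥 | v i = v j ↔ p i j} := by
    ext v
    simp only [mem_preimage, mem_singleton_iff, mem_iInter, mem_ofPred_eq]
    exact Setoid.ext_iff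
  rw [this]
  refine MeasurableSet.iInter fun i => MeasurableSet.iInter fun j => ?_
  have hm : MeasurableSet {v : Fin n → 𝓥 | v i = v j} :=
    measurableSet_eq_fun (measurable_pi_apply i) (measurable_pi_apply j)
  by_cases h : p i j
  · simpa [h] using hm
  · simp only [h, iff_false]
    exact hm.compl

lemma tiePartition_spread {n : ℕ} {T : Type*} (p : Setoid (Fin n)) {u : Quotient p → T} (hu : Function.Injective u) :
    tiePartition (spread p u) = p := by
  ext i j
  change u _ = u _ ↔ _
  rw [hu.eq_iff, Quotient.eq]

lemma measurable_spread (p : Setoid (Fin n)) :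
    Measurable (spread p : (Quotient p → 𝓥) → Fin n → 𝓥) :=
  measurable_pi_lambda _ fun _ => measurable_pi_apply _

lemma spread_preimage_pi {n : ℕ} {T : Type*} (p : Setoid (Fin n)) (A : Fin n → Set T) :
    spread p ⁻¹' (univ.pi A) = univ.pi fun j : Quotient p => ⋂ i ∈ cell p j, A i := by
  ext u
  simp only [mem_preimage, mem_univ_pi, mem_iInter, spread, cell, Finset.mem_filter,
    Finset.mem_univ, true_and]
  exact ⟨fun h j i hi => hi ▸ h i, fun h i => h _ i rfl⟩

end Ties

/-! ### Cell measures and the augmented likelihood on boxes for fixed `w`. -/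

section Cells

variable {n : ℕ} {𝓥 : Type*} [MeasurableSpace 𝓥] {ν : Measure 𝓥} {f : Fin n → 𝓥 → ℝ≥0}

lemma measurable_Omega_uncurry (hf : ∀ i, Measurable (f i)) :
    Measurable fun z : (Fin n → ℝ) × 𝓥 => Omega f z.1 z.2 := by
  unfold Omega
  refine Finset.measurable_fun_sum _ fun i _ => ?_
  exact ((measurable_pi_apply i).comp measurable_fst).mul
    ((hf i).coe_nnreal_real.comp measurable_snd)

lemma measurable_Omega (hf : ∀ i, Measurable (f i)) (w : Fin n → ℝ) : Measurable (Omega f w) :=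
  (measurable_Omega_uncurry hf).comp measurable_prodMk_left

lemma measurable_prod_coe (hf : ∀ i, Measurable (f i)) (C : Finset (Fin n)) :
    Measurable fun v => ∏ i ∈ C, (f i v : ℝ≥0∞) :=
  Finset.measurable_fun_prod _ fun i _ => (hf i).coe_nnreal_ennreal

lemma cellMeasure_eq (hf : ∀ i, Measurable (f i)) (w : Fin n → ℝ) (C : Finset (Fin n)) :
    cellMeasure ν f w C = ν.withDensity fun v =>
      ENNReal.ofReal (Real.exp (-(Omega f w v))) * ∏ i ∈ C, (f i v : ℝ≥0∞) := by
  unfold cellMeasure tilted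
  have := measurable_Omega hf w
  rw [← withDensity_mul _ (by fun_prop) (measurable_prod_coe hf C)]
  rfl

lemma cellMeasure_univ (w : Fin n → ℝ) (C : Finset (Fin n)) :
    cellMeasure ν f w C univ = cellMass ν f w C := by
  rw [cellMeasure, withDensity_apply _ MeasurableSet.univ, Measure.restrict_univ]
  rfl

lemma measurable_cellMeasure_apply [SFinite ν] (hf : ∀ i, Measurable (f i)) (C : Finset (Fin n))
    {S : Set 𝓥} (hS : MeasurableSet S) : Measurable fun w => cellMeasure ν f w C S := by
  simp_rw [cellMeasure_eq hf, withDensity_apply _ hS]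
  refine Measurable.lintegral_prod_right' (f := fun z : (Fin n → ℝ) × 𝓥 =>
    ENNReal.ofReal (Real.exp (-(Omega f z.1 z.2))) * ∏ i ∈ C, (f i z.2 : ℝ≥0∞)) ?_
  have := measurable_Omega_uncurry hf
  exact (by fun_prop : Measurable fun z : (Fin n → ℝ) × 𝓥 =>
    ENNReal.ofReal (Real.exp (-(Omega f z.1 z.2)))).mul
      ((measurable_prod_coe hf C).comp measurable_snd)

lemma measurable_cellMass [SFinite ν] (hf : ∀ i, Measurable (f i)) (C : Finset (Fin n)) :
    Measurable fun w => cellMass ν f w C := by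
  simp_rw [← cellMeasure_univ]
  exact measurable_cellMeasure_apply hf C MeasurableSet.univ

lemma measurable_partitionWeight [SFinite ν] (hf : ∀ i, Measurable (f i)) (p : Setoid (Fin n)) :
    Measurable fun w => partitionWeight ν f w p :=
  Finset.measurable_fun_prod _ fun j _ => measurable_cellMass hf (cell p j)

/-- Bridge from the extended nonnegative cell measures to the real integrals that were
differentiated: a product of indicators over `C` is the indicator of the intersection. -/
lemma cellMeasure_apply_eq_ofReal (hf : ∀ i, Measurable (f i)) {w : Fin n → ℝ}
    {g : 𝓥 → ℝ≥0} (hg : ∀ v, (g v : ℝ) = Omega f w v) {A : Fin n → Set 𝓥}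
    (hA : ∀ i, MeasurableSet (A i)) {C : Finset (Fin n)}
    (hint : Integrable (fun v => (∏ i ∈ C, (((A i).indicator (f i) v : ℝ≥0) : ℝ)) *
      Real.exp (-(g v : ℝ))) ν) :
    cellMeasure ν f w C (⋂ i ∈ C, A i) =
      ENNReal.ofReal (cellIntegral ν g (fun i => (A i).indicator (f i)) C) := by
  classical
  have hS : MeasurableSet (⋂ i ∈ C, A i) := Finset.measurableSet_biInter _ fun i _ => hA i
  rw [cellIntegral, ofReal_integral_eq_lintegral_ofReal hint (Filter.Eventually.of_forall fun v =>
    mul_nonneg (Finset.prod_nonneg fun i _ => NNReal.coe_nonneg _) (Real.exp_pos _).le),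
    cellMeasure_eq hf, withDensity_apply _ hS, ← lintegral_indicator hS]
  refine lintegral_congr fun v => ?_
  rw [hg, ENNReal.ofReal_mul (Finset.prod_nonneg fun i _ => NNReal.coe_nonneg _),
    ENNReal.ofReal_prod_of_nonneg fun i _ => NNReal.coe_nonneg _, mul_comm]
  simp_rw [ENNReal.ofReal_coe_nnreal]
  by_cases hv : v ∈ ⋂ i ∈ C, A i
  · rw [indicator_of_mem hv]
    congr 1
    refine Finset.prod_congr rfl fun i hi => ?_
    rw [indicator_of_mem (mem_iInter₂.1 hv i hi)]
  · rw [indicator_of_notMem hv]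
    simp only [mem_iInter, not_forall] at hv
    obtain ⟨i, hi, hv⟩ := hv
    rw [Finset.prod_eq_zero hi, mul_zero]
    rw [indicator_of_notMem hv]
    rfl

variable (f) in
/-- The function `Ω_n` as a function with values in `ℝ≥0`. -/
def OmegaNN (w : Fin n → ℝ) (v : 𝓥) : ℝ≥0 := ∑ i, (w i).toNNReal * f i v

lemma coe_OmegaNN {n : ℕ} {T : Type*} {f : Fin n → T → ℝ≥0} {w : Fin n → ℝ} (hw : ∀ i, 0 ≤ w i)
    (v : T) : (OmegaNN f w v : ℝ) = Omega f w v := by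
  simp [OmegaNN, Omega, hw]

lemma measurable_OmegaNN (hf : ∀ i, Measurable (f i)) (w : Fin n → ℝ) :
    Measurable (OmegaNN f w) :=
  Finset.measurable_fun_sum _ fun i _ => (hf i).const_mul _

/-- Each `f_i` is at most `w_i⁻¹ Ω_n`; the sum of all `w_l⁻¹` is a constant that serves every `i`.
-/
lemma indicator_le_mul_OmegaNN {n : ℕ} {T : Type*} {f : Fin n → T → ℝ≥0} {w : Fin n → ℝ}
    (hw : ∀ i, 0 < w i) (A : Fin n → Set T) (i : Fin n) (v : T) :
    (A i).indicator (f i) v ≤ (∑ l, (w l).toNNReal⁻¹) * OmegaNN f w v := by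
  have hi : (w i).toNNReal ≠ 0 := by simpa using hw i
  calc (A i).indicator (f i) v ≤ f i v := indicator_le_self' (fun _ _ => zero_le) v
    _ = (w i).toNNReal⁻¹ * ((w i).toNNReal * f i v) := by rw [inv_mul_cancel_left₀ hi]
    _ ≤ _ := by
      refine mul_le_mul' ?_ ?_
      · exact Finset.single_le_sum (f := fun l => (w l).toNNReal⁻¹) (fun _ _ => zero_le)
          (Finset.mem_univ i)
      · exact Finset.single_le_sum (f := fun l => (w l).toNNReal * f l v) (fun _ _ => zero_le)
          (Finset.mem_univ i)

/-- `Ω_n` is linear in `w`, so a multiple of it is again covered by the hypothesis on `Λ`. -/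
lemma Lam_const_mul_OmegaNN_lt_top
    (hΛ : ∀ w : Fin n → ℝ, (∀ i, 0 ≤ w i) → Lam ν (Omega f w) < ∞)
    {w : Fin n → ℝ} (hw : ∀ i, 0 ≤ w i) (c : ℝ≥0) :
    Lam ν (fun v => ((c * OmegaNN f w v : ℝ≥0) : ℝ)) < ∞ := by
  refine (Lam_mono fun v => ?_).trans_lt (hΛ (fun i => c * w i) fun i =>
    mul_nonneg c.coe_nonneg (hw i))
  rw [NNReal.coe_mul, coe_OmegaNN hw]
  simp only [Omega, Finset.mul_sum, mul_assoc, le_refl]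

lemma Lam_coe_OmegaNN_lt_top
    (hΛ : ∀ w : Fin n → ℝ, (∀ i, 0 ≤ w i) → Lam ν (Omega f w) < ∞)
    {w : Fin n → ℝ} (hw : ∀ i, 0 ≤ w i) : Lam ν (fun v => (OmegaNN f w v : ℝ)) < ∞ := by
  simpa using Lam_const_mul_OmegaNN_lt_top hΛ hw 1

lemma cellMass_lt_top (hf : ∀ i, Measurable (f i))
    (hΛ : ∀ w : Fin n → ℝ, (∀ i, 0 ≤ w i) → Lam ν (Omega f w) < ∞)
    {w : Fin n → ℝ} (hw : ∀ i, 0 < w i) {C : Finset (Fin n)} (hC : C.Nonempty) :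
    cellMass ν f w C < ∞ := by
  have h := cellMeasure_apply_eq_ofReal (ν := ν) hf (coe_OmegaNN fun i => (hw i).le)
    (A := fun _ => univ) (C := C) (fun _ => MeasurableSet.univ)
    (integrable_prod_mul_exp_neg (measurable_OmegaNN hf w)
      (fun i => (hf i).indicator MeasurableSet.univ) (indicator_le_mul_OmegaNN hw fun _ => univ)
      (Lam_coe_OmegaNN_lt_top hΛ fun i => (hw i).le) hC)
  rw [show (⋂ i ∈ C, (univ : Set 𝓥)) = univ by simp, cellMeasure_univ] at h
  rw [h]
  exact ENNReal.ofReal_lt_top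

lemma partitionWeight_lt_top (hf : ∀ i, Measurable (f i))
    (hΛ : ∀ w : Fin n → ℝ, (∀ i, 0 ≤ w i) → Lam ν (Omega f w) < ∞)
    {w : Fin n → ℝ} (hw : ∀ i, 0 < w i) (p : Setoid (Fin n)) : partitionWeight ν f w p < ∞ :=
  ENNReal.prod_lt_top fun j _ => cellMass_lt_top hf hΛ hw (cell_nonempty p j)

lemma cellMass_ne_zero_of_partitionWeight_ne_zero {w : Fin n → ℝ} {p : Setoid (Fin n)}
    (h : partitionWeight ν f w p ≠ 0) (j : Quotient p) : cellMass ν f w (cell p j) ≠ 0 :=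
  Finset.prod_ne_zero_iff.1 h j (Finset.mem_univ j)

variable {Ω₀ : Type*} [MeasurableSpace Ω₀] {N : Ω₀ → Measure 𝓥} {P₀ : Measure Ω₀}

lemma IsPoissonRandomMeasure.ae_linFun_component_lt_top [SigmaFinite ν]
    (hN : IsPoissonRandomMeasure N ν P₀) (hf : ∀ i, Measurable (f i))
    (hΛ : ∀ w : Fin n → ℝ, (∀ i, 0 ≤ w i) → Lam ν (Omega f w) < ∞) :
    ∀ᵐ ω ∂P₀, ∀ i, linFun (N ω) (f i) < ∞ := by
  classical
  refine ae_all_iff.2 fun i => hN.ae_linFun_lt_top (hf i) ?_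
  -- `f_i` is `Ω_n` at the `i`-th unit vector.
  refine (Lam_mono fun v => le_of_eq ?_).trans_lt (hΛ (Pi.single i 1) fun l => ?_)
  · simp [Omega, Pi.single_apply]
  · by_cases h : l = i <;> simp [h]

/-- The law of `V` under the augmented likelihood, integrated over a box. -/
theorem IsPoissonRandomMeasure.lintegral_prod_exp_mul_prod [SigmaFinite ν] [IsProbabilityMeasure P₀]
    (hN : IsPoissonRandomMeasure N ν P₀) (hf : ∀ i, Measurable (f i))
    (hΛ : ∀ w : Fin n → ℝ, (∀ i, 0 ≤ w i) → Lam ν (Omega f w) < ∞)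
    {w : Fin n → ℝ} (hw : ∀ i, 0 < w i) {A : Fin n → Set 𝓥} (hA : ∀ i, MeasurableSet (A i)) :
    ∫⁻ ω, (∏ i, ENNReal.ofReal (Real.exp (-(w i * (linFun (N ω) (f i)).toReal)))) *
        ∏ i, linFun (N ω) ((A i).indicator (f i)) ∂P₀ =
      ENNReal.ofReal (Real.exp (-(Lam ν (Omega f w)).toReal)) *
        ∑ p : Setoid (Fin n), ∏ j : Quotient p,
          cellMeasure ν f w (cell p j) (⋂ i ∈ cell p j, A i) := by
  have hw0 : ∀ i, 0 ≤ w i := fun i => (hw i).le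
  have hg := measurable_OmegaNN hf w
  have hh : ∀ i, Measurable ((A i).indicator (f i)) := fun i => (hf i).indicator (hA i)
  have hK := indicator_le_mul_OmegaNN (f := f) hw A
  have hΛ1 := Lam_coe_OmegaNN_lt_top hΛ hw0
  have hLam : Lam ν (Omega f w) = Lam ν (fun v => (OmegaNN f w v : ℝ)) := by
    congr 1
    ext v
    exact (coe_OmegaNN hw0 v).symm
  have hcell : ∀ (p : Setoid (Fin n)) (j : Quotient p),
      cellMeasure ν f w (cell p j) (⋂ i ∈ cell p j, A i) = ENNReal.ofReal
        (cellIntegral ν (OmegaNN f w) (fun i => (A i).indicator (f i)) (cell p j)) := fun p j =>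
    cellMeasure_apply_eq_ofReal hf (coe_OmegaNN hw0) hA
      (integrable_prod_mul_exp_neg hg hh hK hΛ1 (cell_nonempty p j))
  have hcell0 : ∀ C, 0 ≤ cellIntegral ν (OmegaNN f w) (fun i => (A i).indicator (f i)) C :=
    fun C => integral_nonneg fun v =>
      mul_nonneg (Finset.prod_nonneg fun i _ => NNReal.coe_nonneg _) (Real.exp_pos _).le
  simp_rw [hcell, ← ENNReal.ofReal_prod_of_nonneg fun j _ => hcell0 _]
  rw [← ENNReal.ofReal_sum_of_nonneg fun p _ => Finset.prod_nonneg fun j _ => hcell0 _,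
    ← ENNReal.ofReal_mul (Real.exp_pos _).le, hLam,
    ← hN.integral_exp_neg_mul_prod hg hh hK (Lam_const_mul_OmegaNN_lt_top hΛ hw0),
    ofReal_integral_eq_lintegral_ofReal (hN.integrable_exp_neg_mul_prod hg hh hK hΛ1)
      (Filter.Eventually.of_forall fun ω => mul_nonneg (Real.exp_pos _).le
        (Finset.prod_nonneg fun i _ => ENNReal.toReal_nonneg))]
  refine lintegral_congr_ae ?_
  filter_upwards [hN.ae_linFun_component_lt_top hf hΛ] with ω hω
  rw [ENNReal.ofReal_mul (Real.exp_pos _).le,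
    ENNReal.ofReal_prod_of_nonneg fun i _ => ENNReal.toReal_nonneg,
    ← ENNReal.ofReal_prod_of_nonneg fun i _ => (Real.exp_pos _).le, ← Real.exp_sum,
    Finset.sum_neg_distrib]
  congr 1
  · congr 3
    -- The exponents combine to `N(Ω_n) = ∑ w_i τ_i`; passing to real numbers needs every `τ_i`
    -- finite.
    have hsum : linFun (N ω) (OmegaNN f w) = ∑ i, ((w i).toNNReal : ℝ≥0∞) * linFun (N ω) (f i) := by
      unfold linFun OmegaNN
      push_cast
      rw [lintegral_finsetSum _ fun i _ => (hf i).coe_nnreal_ennreal.const_mul _]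
      exact Finset.sum_congr rfl fun i _ => lintegral_const_mul _ (hf i).coe_nnreal_ennreal
    rw [hsum, ENNReal.toReal_sum fun i _ => ENNReal.mul_ne_top ENNReal.coe_ne_top (hω i).ne]
    refine Finset.sum_congr rfl fun i _ => ?_
    rw [ENNReal.toReal_mul, ENNReal.coe_toReal, Real.coe_toNNReal _ (hw0 i)]
  · refine Finset.prod_congr rfl fun i _ => (ENNReal.ofReal_toReal ?_).symm
    refine ne_top_of_le_ne_top (hω i).ne (lintegral_mono fun v => ?_)
    exact ENNReal.coe_le_coe.2 (indicator_le_self' (fun _ _ => zero_le) v)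

end Cells

/-! ### The law of the values given the partition and `w`. -/

section CellsKernel

variable {n : ℕ} {𝓥 : Type*} [MeasurableSpace 𝓥] {ν : Measure 𝓥} {f : Fin n → 𝓥 → ℝ≥0}

lemma isProbabilityMeasure_cellLaw {w : Fin n → ℝ} {C : Finset (Fin n)}
    (h0 : cellMass ν f w C ≠ 0) (h1 : cellMass ν f w C ≠ ∞) :
    IsProbabilityMeasure (cellLaw ν f w C) := by
  refine ⟨?_⟩
  rw [cellLaw, Measure.smul_apply, cellMeasure_univ, smul_eq_mul, ENNReal.inv_mul_cancel h0 h1]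

instance instNullSingletonClassCellLaw [NullSingletonClass ν] (w : Fin n → ℝ)
    (C : Finset (Fin n)) : NullSingletonClass (cellLaw ν f w C) := by
  refine ⟨fun x => ?_⟩
  have h : cellMeasure ν f w C ≪ ν :=
    (withDensity_absolutelyContinuous _ _).trans (withDensity_absolutelyContinuous _ _)
  rw [cellLaw, Measure.smul_apply, h (measure_singleton x), smul_zero]

/-- The cells of `p` all have a positive and finite mass. -/
def IsRegularAt (ν : Measure 𝓥) (f : Fin n → 𝓥 → ℝ≥0) (p : Setoid (Fin n)) (w : Fin n → ℝ) :
    Prop :=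
  ∀ j : Quotient p, 0 < cellMass ν f w (cell p j) ∧ cellMass ν f w (cell p j) < ∞

lemma measurableSet_isRegularAt [SFinite ν] (hf : ∀ i, Measurable (f i)) (p : Setoid (Fin n)) :
    MeasurableSet {w | IsRegularAt ν f p w} := by
  have : {w | IsRegularAt ν f p w} = ⋂ j : Quotient p,
      (fun w => cellMass ν f w (cell p j)) ⁻¹' Ioo 0 ∞ := by
    ext w
    simp [IsRegularAt]
  rw [this]
  exact MeasurableSet.iInter fun j => measurable_cellMass hf _ measurableSet_Ioo

lemma isRegularAt_of_partitionWeight_ne_zero (hf : ∀ i, Measurable (f i))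
    (hΛ : ∀ w : Fin n → ℝ, (∀ i, 0 ≤ w i) → Lam ν (Omega f w) < ∞)
    {w : Fin n → ℝ} (hw : ∀ i, 0 < w i) {p : Setoid (Fin n)} (h : partitionWeight ν f w p ≠ 0) :
    IsRegularAt ν f p w := fun j =>
  ⟨pos_iff_ne_zero.2 (cellMass_ne_zero_of_partitionWeight_ne_zero h j),
    cellMass_lt_top hf hΛ hw (cell_nonempty p j)⟩

open Classical in
/-- The law of `V` given the partition `p` and `W = w`. -/
def cellsLaw [Nonempty 𝓥] (ν : Measure 𝓥) (f : Fin n → 𝓥 → ℝ≥0) (p : Setoid (Fin n))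
    (w : Fin n → ℝ) : Measure (Fin n → 𝓥) :=
  if IsRegularAt ν f p w then
    (Measure.pi fun j : Quotient p => cellLaw ν f w (cell p j)).map (spread p)
  else Measure.dirac fun _ => Classical.arbitrary 𝓥

variable [Nonempty 𝓥]

lemma cellsLaw_of_isRegularAt {p : Setoid (Fin n)} {w : Fin n → ℝ} (h : IsRegularAt ν f p w) :
    cellsLaw ν f p w =
      (Measure.pi fun j : Quotient p => cellLaw ν f w (cell p j)).map (spread p) :=
  if_pos h

instance instIsProbabilityMeasureCellsLaw (p : Setoid (Fin n)) (w : Fin n → ℝ) :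
    IsProbabilityMeasure (cellsLaw ν f p w) := by
  by_cases h : IsRegularAt ν f p w
  · rw [cellsLaw_of_isRegularAt h]
    have := fun j => isProbabilityMeasure_cellLaw (h j).1.ne' (h j).2.ne
    exact Measure.isProbabilityMeasure_map (measurable_spread p).aemeasurable
  · rw [cellsLaw, if_neg h]
    infer_instance

lemma cellsLaw_apply_pi {p : Setoid (Fin n)} {w : Fin n → ℝ} (h : IsRegularAt ν f p w)
    {A : Fin n → Set 𝓥} (hA : ∀ i, MeasurableSet (A i)) :
    cellsLaw ν f p w (univ.pi A) = ∏ j : Quotient p, ((cellMass ν f w (cell p j))⁻¹ *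
      cellMeasure ν f w (cell p j) (⋂ i ∈ cell p j, A i)) := by
  have := fun j => isProbabilityMeasure_cellLaw (h j).1.ne' (h j).2.ne
  rw [cellsLaw_of_isRegularAt h, Measure.map_apply (measurable_spread p)
    (MeasurableSet.univ_pi hA), spread_preimage_pi, Measure.pi_pi]
  rfl

/-- Because of the Dirac default, `cellsLaw` is a probability measure for every `w`, so
measurability may be tested on the π-system of boxes, where the mass is explicit. -/
lemma measurable_cellsLaw [SFinite ν] (hf : ∀ i, Measurable (f i)) (p : Setoid (Fin n)) :
    Measurable fun w => cellsLaw ν f p w := by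
  classical
  refine Measurable.measure_of_isPiSystem_of_isProbabilityMeasure generateFrom_pi.symm
    isPiSystem_pi ?_
  rintro _ ⟨A, hA, rfl⟩
  have hA' : ∀ i, MeasurableSet (A i) := fun i => hA i (mem_univ i)
  have heq : (fun w => cellsLaw ν f p w (univ.pi A)) = fun w =>
      if IsRegularAt ν f p w then ∏ j : Quotient p, ((cellMass ν f w (cell p j))⁻¹ *
        cellMeasure ν f w (cell p j) (⋂ i ∈ cell p j, A i))
      else Measure.dirac (fun _ => Classical.arbitrary 𝓥) (univ.pi A) := by
    ext w
    split_ifs with h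
    · exact cellsLaw_apply_pi h hA'
    · rw [cellsLaw, if_neg h]
  rw [heq]
  refine Measurable.ite (measurableSet_isRegularAt hf p) ?_ measurable_const
  exact Finset.measurable_fun_prod _ fun j _ => (measurable_cellMass hf _).inv.mul
    (measurable_cellMeasure_apply hf _ (Finset.measurableSet_biInter _ fun i _ => hA' i))

/-- The weight undoes the normalisation cell by cell. If it vanishes, the default in `cellsLaw` is
harmless: some cell measure is zero and so are both sides. -/
lemma partitionWeight_mul_cellsLaw_apply_pi (hf : ∀ i, Measurable (f i))
    (hΛ : ∀ w : Fin n → ℝ, (∀ i, 0 ≤ w i) → Lam ν (Omega f w) < ∞)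
    {w : Fin n → ℝ} (hw : ∀ i, 0 < w i) (p : Setoid (Fin n))
    {A : Fin n → Set 𝓥} (hA : ∀ i, MeasurableSet (A i)) :
    partitionWeight ν f w p * cellsLaw ν f p w (univ.pi A) =
      ∏ j : Quotient p, cellMeasure ν f w (cell p j) (⋂ i ∈ cell p j, A i) := by
  by_cases h : partitionWeight ν f w p = 0
  · rw [h, zero_mul]
    obtain ⟨j, hj, hj0⟩ := Finset.prod_eq_zero_iff.1 h
    refine (Finset.prod_eq_zero hj ?_).symm
    rw [← cellMeasure_univ] at hj0
    exact measure_mono_null (subset_univ _) hj0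
  · have hr := isRegularAt_of_partitionWeight_ne_zero hf hΛ hw h
    rw [cellsLaw_apply_pi hr hA, partitionWeight, ← Finset.prod_mul_distrib]
    refine Finset.prod_congr rfl fun j _ => ?_
    rw [← mul_assoc, ENNReal.mul_inv_cancel (hr j).1.ne' (hr j).2.ne, one_mul]

/-- The cell laws inherit the absence of atoms from `ν`, so the independent values of different
cells are almost surely distinct and create no further ties. -/
lemma ae_tiePartition_cellsLaw [MeasurableEq 𝓥] [MeasurableSingletonClass 𝓥]
    [NullSingletonClass ν] {p : Setoid (Fin n)} {w : Fin n → ℝ} (h : IsRegularAt ν f p w) :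
    ∀ᵐ v ∂(cellsLaw ν f p w), tiePartition v = p := by
  have := fun j => isProbabilityMeasure_cellLaw (h j).1.ne' (h j).2.ne
  have hm : MeasurableSet {v : Fin n → 𝓥 | tiePartition v = p} :=
    measurable_tiePartition (measurableSet_singleton p)
  rw [cellsLaw_of_isRegularAt h, ae_map_iff (measurable_spread p).aemeasurable hm]
  have hne : ∀ᵐ u ∂(Measure.pi fun j : Quotient p => cellLaw ν f w (cell p j)),
      ∀ j j' : Quotient p, j ≠ j' → u j ≠ u j' := by
    refine ae_all_iff.2 fun j => ae_all_iff.2 fun j' => ?_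
    by_cases hjj : j = j'
    · exact Filter.Eventually.of_forall fun u hne => absurd hjj hne
    · rw [ae_iff]
      refine measure_mono_null (fun u hu => ?_) (pi_eval_eq_eval_null _ hjj)
      simpa [hjj] using hu
  filter_upwards [hne] with u hu
  exact tiePartition_spread p fun j j' hjj => by_contra fun h => hu j j' h hjj

end CellsKernel

/-! ### The joint law of the partition, the latent variables and the values. -/

section Law

variable {n : ℕ} {𝓥 : Type*} [MeasurableSpace 𝓥] {ν : Measure 𝓥} {f : Fin n → 𝓥 → ℝ≥0}
  {Ω₀ : Type*} [MeasurableSpace Ω₀] {N : Ω₀ → Measure 𝓥} {P₀ : Measure Ω₀}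
  {k : ℕ} {μ Δ a₀ : ℝ} {a β : Fin k → ℝ}

lemma measurable_prod_apply_apply {n : ℕ} {F : ℝ → ℝ → ℝ≥0∞}
    (hF : Measurable fun z : ℝ × ℝ => F z.1 z.2) :
    Measurable fun y : (Fin n → ℝ) × (Fin n → ℝ) => ∏ i, F (y.1 i) (y.2 i) := by
  have hi : ∀ i : Fin n, Measurable fun y : (Fin n → ℝ) × (Fin n → ℝ) => (y.1 i, y.2 i) :=
    fun i => by fun_prop
  exact Finset.measurable_fun_prod _ fun i _ => hF.comp (hi i)

lemma measurable_prod_obsDensity (μ Δ a₀ : ℝ) (a β : Fin k → ℝ) :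
    Measurable fun y : (Fin n → ℝ) × (Fin n → ℝ) => ∏ i, obsDensity μ Δ a₀ a β (y.1 i) (y.2 i) := by
  have h : Measurable fun z : ℝ × ℝ => obsDensity μ Δ a₀ a β z.1 z.2 := by
    have hm : Measurable fun z : ℝ × ℝ => μ * Δ + ∑ j, β j * z.1 ^ (-a j) :=
      (Finset.measurable_fun_sum _ fun j _ => (measurable_fst.pow_const _).const_mul _).const_add _
    have hv : Measurable fun z : ℝ × ℝ => ((Real.toNNReal (z.1 ^ (-2 * a₀)) : ℝ≥0) : ℝ) :=
      (measurable_fst.pow_const _).real_toNNReal.coe_nnreal_real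
    have h1 : Measurable fun z : ℝ × ℝ =>
        (√(2 * Real.pi * ((Real.toNNReal (z.1 ^ (-2 * a₀)) : ℝ≥0) : ℝ)))⁻¹ :=
      (hv.const_mul _).sqrt.inv
    have h2 : Measurable fun z : ℝ × ℝ =>
        Real.exp (-(z.2 - (μ * Δ + ∑ j, β j * z.1 ^ (-a j))) ^ 2 /
          (2 * ((Real.toNNReal (z.1 ^ (-2 * a₀)) : ℝ≥0) : ℝ))) :=
      Real.measurable_exp.comp
        ((((measurable_snd.sub hm).pow_const 2).neg).div (hv.const_mul 2))
    have h3 := (h1.mul h2).ennreal_ofReal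
    simp only [Pi.mul_apply] at h3
    simpa only [obsDensity, gaussianPDF, gaussianPDFReal] using h3
  exact measurable_prod_apply_apply h

lemma measurable_Lam_Omega [SFinite ν] (hf : ∀ i, Measurable (f i)) :
    Measurable fun w => Lam ν (Omega f w) := by
  refine Measurable.lintegral_prod_right' (f := fun z : (Fin n → ℝ) × 𝓥 =>
    ENNReal.ofReal (1 - Real.exp (-(Omega f z.1 z.2)))) ?_
  have := measurable_Omega_uncurry hf
  fun_prop

variable (n) in
/-- Lebesgue measure on `(0,∞)ⁿ × ℝⁿ`. -/
def latentVolume : Measure ((Fin n → ℝ) × (Fin n → ℝ)) :=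
  (volume.restrict (univ.pi fun _ => Ioi (0 : ℝ))).prod volume

instance : SigmaFinite (latentVolume n) := by
  unfold latentVolume
  infer_instance

lemma ae_latentVolume_pos : ∀ᵐ y ∂(latentVolume n), ∀ i, 0 < y.1 i := by
  have h : ∀ᵐ w ∂((volume : Measure (Fin n → ℝ)).restrict (univ.pi fun _ => Ioi (0 : ℝ))),
      ∀ i, 0 < w i := by
    filter_upwards [ae_restrict_mem (MeasurableSet.univ_pi fun _ => measurableSet_Ioi)] with w hw i
    exact hw i (mem_univ i)
  exact Measure.quasiMeasurePreserving_fst.ae h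

/-- Tonelli: `v` is integrated out for fixed `ω`, then `ω` and `(w, x)` are exchanged so that the
moment formula applies pointwise in `(w, x)`. -/
lemma augmentedIntegral_box [SigmaFinite ν] [IsProbabilityMeasure P₀]
    (hN : IsPoissonRandomMeasure N ν P₀) (hf : ∀ i, Measurable (f i))
    (hΛ : ∀ w : Fin n → ℝ, (∀ i, 0 ≤ w i) → Lam ν (Omega f w) < ∞)
    {A : Fin n → Set 𝓥} (hA : ∀ i, MeasurableSet (A i)) {B : Set ((Fin n → ℝ) × (Fin n → ℝ))}
    (hB : MeasurableSet B) :
    augmentedIntegral P₀ N f μ Δ a₀ a β (fun z => (univ.pi A).indicator 1 z.1 *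
      B.indicator 1 z.2) =
      ∫⁻ y in B, (∏ i, obsDensity μ Δ a₀ a β (y.1 i) (y.2 i)) *
        (ENNReal.ofReal (Real.exp (-(Lam ν (Omega f y.1)).toReal)) *
        ∑ p : Setoid (Fin n), ∏ j : Quotient p,
          cellMeasure ν f y.1 (cell p j) (⋂ i ∈ cell p j, A i)) ∂(latentVolume n) := by
  have hO := measurable_prod_obsDensity (n := n) μ Δ a₀ a β
  have hBm : Measurable (B.indicator (1 : (Fin n → ℝ) × (Fin n → ℝ) → ℝ≥0∞)) :=
    measurable_one.indicator hB
  set T : Ω₀ → ℝ≥0∞ := fun ω => ∏ i, linFun (N ω) ((A i).indicator (f i)) with hT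
  have hTm : Measurable T := Finset.measurable_fun_prod _ fun i _ =>
    hN.measurable_linFun ((hf i).indicator (hA i))
  set E : Ω₀ × ((Fin n → ℝ) × (Fin n → ℝ)) → ℝ≥0∞ := fun z =>
    ∏ i, ENNReal.ofReal (Real.exp (-(z.2.1 i * (linFun (N z.1) (f i)).toReal))) with hE
  have hEm : Measurable E := by
    refine Finset.measurable_fun_prod _ fun i _ => ?_
    have h1 : Measurable fun z : Ω₀ × ((Fin n → ℝ) × (Fin n → ℝ)) =>
        (linFun (N z.1) (f i)).toReal :=
      ((hN.measurable_linFun (hf i)).comp measurable_fst).ennreal_toReal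
    fun_prop
  -- The indicator of the box is absorbed into the `f_i`, and the integral over `v` factorises.
  have hinner : ∀ ω, SigmaFinite (N ω) → ∀ y : (Fin n → ℝ) × (Fin n → ℝ),
      ∫⁻ v, ((univ.pi A).indicator 1 v * B.indicator 1 y) * ∏ i, (f i (v i) : ℝ≥0∞)
        ∂(Measure.pi fun _ : Fin n => N ω) = B.indicator 1 y * T ω := by
    intro ω hω y
    have hm : ∀ i, Measurable fun x => (((A i).indicator (f i) x : ℝ≥0) : ℝ≥0∞) := fun i =>
      ((hf i).indicator (hA i)).coe_nnreal_ennreal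
    have h1 : ∀ v : Fin n → 𝓥, ((univ.pi A).indicator 1 v * B.indicator 1 y) *
        ∏ i, (f i (v i) : ℝ≥0∞) =
        B.indicator 1 y * ∏ i, (((A i).indicator (f i) (v i) : ℝ≥0) : ℝ≥0∞) := by
      intro v
      rw [mul_comm ((univ.pi A).indicator 1 v), mul_assoc]
      congr 1
      by_cases hv : v ∈ univ.pi A
      · rw [indicator_of_mem hv, Pi.one_apply, one_mul]
        refine Finset.prod_congr rfl fun i _ => ?_
        rw [indicator_of_mem (hv i (mem_univ i))]
      · rw [indicator_of_notMem hv, zero_mul]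
        simp only [mem_univ_pi, not_forall] at hv
        obtain ⟨i, hi⟩ := hv
        refine (Finset.prod_eq_zero (Finset.mem_univ i) ?_).symm
        rw [indicator_of_notMem hi, ENNReal.coe_zero]
    simp_rw [h1]
    have hm' : Measurable fun v : Fin n → 𝓥 =>
        ∏ i, (((A i).indicator (f i) (v i) : ℝ≥0) : ℝ≥0∞) :=
      Finset.measurable_fun_prod _ fun i _ => (hm i).comp (measurable_pi_apply i)
    rw [lintegral_const_mul _ hm', lintegral_pi_prod _ hm]
    rfl
  have hstep : augmentedIntegral P₀ N f μ Δ a₀ a β (fun z => (univ.pi A).indicator 1 z.1 *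
      B.indicator 1 z.2) = ∫⁻ ω, ∫⁻ y, E (ω, y) * (∏ i, obsDensity μ Δ a₀ a β (y.1 i) (y.2 i)) *
        (B.indicator 1 y * T ω) ∂(latentVolume n) ∂P₀ := by
    refine lintegral_congr_ae ?_
    filter_upwards [hN.ae_sigmaFinite] with ω hω
    have hm : Measurable fun y : (Fin n → ℝ) × (Fin n → ℝ) =>
        E (ω, y) * (∏ i, obsDensity μ Δ a₀ a β (y.1 i) (y.2 i)) * (B.indicator 1 y * T ω) :=
      ((hEm.comp measurable_prodMk_left).mul hO).mul (hBm.mul_const _)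
    rw [latentVolume, lintegral_prod _ hm.aemeasurable]
    refine lintegral_congr fun w => lintegral_congr fun x => ?_
    rw [hinner ω hω (w, x)]
  rw [hstep, lintegral_lintegral_swap, ← lintegral_indicator hB]
  · refine lintegral_congr_ae ?_
    filter_upwards [ae_latentVolume_pos] with y hy
    have hrw : ∀ ω, E (ω, y) * (∏ i, obsDensity μ Δ a₀ a β (y.1 i) (y.2 i)) *
        (B.indicator 1 y * T ω) = (B.indicator 1 y * ∏ i, obsDensity μ Δ a₀ a β (y.1 i) (y.2 i)) *
        (E (ω, y) * T ω) := fun ω => by ring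
    simp_rw [hrw]
    have hETm : Measurable fun ω => E (ω, y) * T ω := (hEm.comp measurable_prodMk_right).mul hTm
    rw [lintegral_const_mul _ hETm,
      hN.lintegral_prod_exp_mul_prod hf hΛ hy hA]
    by_cases hyB : y ∈ B
    · rw [indicator_of_mem hyB, indicator_of_mem hyB, Pi.one_apply, one_mul]
    · rw [indicator_of_notMem hyB, indicator_of_notMem hyB, zero_mul, zero_mul]
  · have h1 : Measurable fun z : Ω₀ × ((Fin n → ℝ) × (Fin n → ℝ)) =>
        E z * (∏ i, obsDensity μ Δ a₀ a β (z.2.1 i) (z.2.2 i)) * (B.indicator 1 z.2 * T z.1) :=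
      (hEm.mul (hO.comp measurable_snd)).mul
        ((hBm.comp measurable_snd).mul (hTm.comp measurable_fst))
    exact h1.aemeasurable

/-- The joint law of `(W, X)` and of the event that the partition is `p`, for a density `ρ`. -/
def latentLaw (ν : Measure 𝓥) (f : Fin n → 𝓥 → ℝ≥0)
    (ρ : (Fin n → ℝ) × (Fin n → ℝ) → ℝ≥0∞) (p : Setoid (Fin n)) :
    Measure ((Fin n → ℝ) × (Fin n → ℝ)) :=
  (latentVolume n).withDensity fun y => ρ y * partitionWeight ν f y.1 p

instance (ρ : (Fin n → ℝ) × (Fin n → ℝ) → ℝ≥0∞) (p : Setoid (Fin n)) :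
    SFinite (latentLaw ν f ρ p) := by
  unfold latentLaw
  infer_instance

lemma ae_latentLaw_regular [SFinite ν] (hf : ∀ i, Measurable (f i))
    (hΛ : ∀ w : Fin n → ℝ, (∀ i, 0 ≤ w i) → Lam ν (Omega f w) < ∞)
    {ρ : (Fin n → ℝ) × (Fin n → ℝ) → ℝ≥0∞} (hρ : Measurable ρ) (p : Setoid (Fin n)) :
    ∀ᵐ y ∂(latentLaw ν f ρ p), (∀ i, 0 < y.1 i) ∧ IsRegularAt ν f p y.1 := by
  have hm : Measurable fun y : (Fin n → ℝ) × (Fin n → ℝ) => ρ y * partitionWeight ν f y.1 p :=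
    hρ.mul ((measurable_partitionWeight hf p).comp measurable_fst)
  rw [latentLaw, ae_withDensity_iff hm]
  filter_upwards [ae_latentVolume_pos] with y hy hne
  exact ⟨hy, isRegularAt_of_partitionWeight_ne_zero hf hΛ hy (right_ne_zero_of_mul hne)⟩

variable [Nonempty 𝓥]

/-- The law of `V` given `p`, as a kernel in `(w, x)`. -/
def cellsKernel [SFinite ν] (hf : ∀ i, Measurable (f i)) (p : Setoid (Fin n)) :
    Kernel ((Fin n → ℝ) × (Fin n → ℝ)) (Fin n → 𝓥) where
  toFun y := cellsLaw ν f p y.1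
  measurable' := (measurable_cellsLaw hf p).comp measurable_fst

instance [SFinite ν] (hf : ∀ i, Measurable (f i)) (p : Setoid (Fin n)) :
    IsMarkovKernel (cellsKernel (ν := ν) hf p) :=
  ⟨fun y => instIsProbabilityMeasureCellsLaw p y.1⟩

variable {Ω : Type*} [MeasurableSpace Ω] {P : Measure Ω} {V : Ω → Fin n → 𝓥} {W X : Ω → Fin n → ℝ}

/-- The box formula, with each cell measure rewritten as mass times normalised law, shows that both
measures agree on products `B × ∏ A_i`, a generating π-system. The function `ρ` collects `c`, the
normal densities and `e^{-Λ(Ω_n)}`. -/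
lemma IsAugmentedSample.exists_map_eq [SigmaFinite ν] [IsProbabilityMeasure P₀]
    [IsProbabilityMeasure P] (hN : IsPoissonRandomMeasure N ν P₀) (hf : ∀ i, Measurable (f i))
    (hΛ : ∀ w : Fin n → ℝ, (∀ i, 0 ≤ w i) → Lam ν (Omega f w) < ∞)
    (hVWX : IsAugmentedSample P₀ N f μ Δ a₀ a β P V W X) :
    ∃ ρ : (Fin n → ℝ) × (Fin n → ℝ) → ℝ≥0∞, Measurable ρ ∧
      P.map (fun ω => ((W ω, X ω), V ω)) =
        ∑ p : Setoid (Fin n), latentLaw ν f ρ p ⊗ₘ cellsKernel (ν := ν) hf p := by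
  obtain ⟨c, hc⟩ := hVWX.law
  have hO := measurable_prod_obsDensity (n := n) μ Δ a₀ a β
  have hL : Measurable fun y : (Fin n → ℝ) × (Fin n → ℝ) =>
      ENNReal.ofReal (Real.exp (-(Lam ν (Omega f y.1)).toReal)) := by
    have : Measurable fun y : (Fin n → ℝ) × (Fin n → ℝ) => (Lam ν (Omega f y.1)).toReal :=
      ((measurable_Lam_Omega hf).comp measurable_fst).ennreal_toReal
    exact (Real.measurable_exp.comp this.neg).ennreal_ofReal
  set ρ : (Fin n → ℝ) × (Fin n → ℝ) → ℝ≥0∞ := fun y =>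
    c * ((∏ i, obsDensity μ Δ a₀ a β (y.1 i) (y.2 i)) *
      ENNReal.ofReal (Real.exp (-(Lam ν (Omega f y.1)).toReal))) with hρdef
  have hρ : Measurable ρ := (hO.mul hL).const_mul c
  refine ⟨ρ, hρ, ?_⟩
  have hmeas : Measurable fun ω => ((W ω, X ω), V ω) :=
    (hVWX.measurable_W.prodMk hVWX.measurable_X).prodMk hVWX.measurable_V
  have : IsProbabilityMeasure (P.map fun ω => ((W ω, X ω), V ω)) :=
    Measure.isProbabilityMeasure_map hmeas.aemeasurable
  have hbox : ∀ (A : Fin n → Set 𝓥), (∀ i, MeasurableSet (A i)) →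
      ∀ B : Set ((Fin n → ℝ) × (Fin n → ℝ)), MeasurableSet B →
      P.map (fun ω => ((W ω, X ω), V ω)) (B ×ˢ univ.pi A) =
        (∑ p : Setoid (Fin n), latentLaw ν f ρ p ⊗ₘ cellsKernel (ν := ν) hf p) (B ×ˢ univ.pi A) := by
    intro A hA B hB
    have hAm : MeasurableSet (univ.pi A) := MeasurableSet.univ_pi hA
    rw [Measure.map_apply hmeas (hB.prod hAm),
      ← lintegral_indicator_one (hmeas (hB.prod hAm))]
    have hg := hc (fun z => (univ.pi A).indicator 1 z.1 * B.indicator 1 z.2)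
      (((measurable_one.indicator hAm).comp measurable_fst).mul
        ((measurable_one.indicator hB).comp measurable_snd))
    have hind : ∀ ω, ((fun ω => ((W ω, X ω), V ω)) ⁻¹' B ×ˢ univ.pi A).indicator
        (1 : Ω → ℝ≥0∞) ω = (univ.pi A).indicator 1 (V ω) * B.indicator 1 (W ω, X ω) := by
      intro ω
      by_cases h1 : (W ω, X ω) ∈ B <;> by_cases h2 : V ω ∈ univ.pi A <;>
        simp [indicator, h1, h2, -mem_pi]
    simp_rw [hind]
    have hcm : ∀ p : Setoid (Fin n), Measurable fun y : (Fin n → ℝ) × (Fin n → ℝ) =>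
        ∏ j : Quotient p, cellMeasure ν f y.1 (cell p j) (⋂ i ∈ cell p j, A i) := fun p =>
      Finset.measurable_fun_prod _ fun j _ => (measurable_cellMeasure_apply hf _
        (Finset.measurableSet_biInter _ fun i _ => hA i)).comp measurable_fst
    have hwt : ∀ p : Setoid (Fin n), Measurable fun y : (Fin n → ℝ) × (Fin n → ℝ) =>
        ρ y * partitionWeight ν f y.1 p := fun p =>
      hρ.mul ((measurable_partitionWeight hf p).comp measurable_fst)
    have hterm : ∀ p : Setoid (Fin n), (latentLaw ν f ρ p ⊗ₘ cellsKernel (ν := ν) hf p) (B ×ˢ univ.pi A) =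
        ∫⁻ y in B, ρ y * ∏ j : Quotient p,
          cellMeasure ν f y.1 (cell p j) (⋂ i ∈ cell p j, A i) ∂(latentVolume n) := by
      intro p
      rw [Measure.compProd_apply_prod hB hAm, latentLaw,
        setLIntegral_withDensity_eq_setLIntegral_mul _ (hwt p)
          (Kernel.measurable_coe _ hAm) hB]
      refine lintegral_congr_ae ?_
      filter_upwards [ae_restrict_of_ae ae_latentVolume_pos] with y hy
      rw [Pi.mul_apply, mul_assoc]
      congr 1
      exact partitionWeight_mul_cellsLaw_apply_pi hf hΛ hy p hA
    have hfun : Measurable fun y : (Fin n → ℝ) × (Fin n → ℝ) =>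
        (∏ i, obsDensity μ Δ a₀ a β (y.1 i) (y.2 i)) *
        (ENNReal.ofReal (Real.exp (-(Lam ν (Omega f y.1)).toReal)) *
        ∑ p : Setoid (Fin n), ∏ j : Quotient p,
          cellMeasure ν f y.1 (cell p j) (⋂ i ∈ cell p j, A i)) :=
      hO.mul (hL.mul (Finset.measurable_fun_sum _ fun p _ => hcm p))
    rw [hg, augmentedIntegral_box hN hf hΛ hA hB, ← lintegral_const_mul _ hfun,
      Measure.finsetSum_apply]
    simp_rw [hterm]
    have hρcm : ∀ p : Setoid (Fin n), Measurable fun y : (Fin n → ℝ) × (Fin n → ℝ) =>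
        ρ y * ∏ j : Quotient p, cellMeasure ν f y.1 (cell p j) (⋂ i ∈ cell p j, A i) := fun p =>
      hρ.mul (hcm p)
    rw [← lintegral_finsetSum _ fun p _ => hρcm p]
    refine lintegral_congr fun y => ?_
    rw [← Finset.mul_sum, hρdef]
    ring
  have hspan : IsCountablySpanning
      (univ.pi '' univ.pi fun _ : Fin n => {s : Set 𝓥 | MeasurableSet s}) :=
    ⟨fun _ => univ, fun _ => ⟨fun _ => univ, fun _ _ => MeasurableSet.univ, pi_univ _⟩,
      iUnion_const _⟩
  refine ext_of_generate_finite _ (generateFrom_eq_prod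
    MeasurableSpace.generateFrom_measurableSet
    generateFrom_pi isCountablySpanning_measurableSet hspan).symm
    (MeasurableSpace.isPiSystem_measurableSet.prod isPiSystem_pi) ?_ ?_
  · rintro _ ⟨B, hB, _, ⟨A, hA, rfl⟩, rfl⟩
    exact hbox A (fun i => hA i (mem_univ i)) B hB
  · have := hbox (fun _ => univ) (fun _ => MeasurableSet.univ) univ MeasurableSet.univ
    rwa [pi_univ, univ_prod_univ] at this

/-- The joint law of `(p, W, X, V)`. -/
lemma IsAugmentedSample.exists_lintegral_eq [SigmaFinite ν] [NullSingletonClass ν]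
    [MeasurableEq 𝓥] [MeasurableSingletonClass 𝓥] [IsProbabilityMeasure P₀]
    [IsProbabilityMeasure P] (hN : IsPoissonRandomMeasure N ν P₀) (hf : ∀ i, Measurable (f i))
    (hΛ : ∀ w : Fin n → ℝ, (∀ i, 0 ≤ w i) → Lam ν (Omega f w) < ∞)
    (hVWX : IsAugmentedSample P₀ N f μ Δ a₀ a β P V W X) :
    ∃ ρ : (Fin n → ℝ) × (Fin n → ℝ) → ℝ≥0∞, Measurable ρ ∧
      ∀ H : (Setoid (Fin n) × (Fin n → ℝ) × (Fin n → ℝ)) × (Fin n → 𝓥) → ℝ≥0∞, Measurable H →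
        ∫⁻ ω, H ((tiePartition (V ω), W ω, X ω), V ω) ∂P =
          ∑ p : Setoid (Fin n), ∫⁻ y, ∫⁻ v, H ((p, y), v) ∂(cellsKernel (ν := ν) hf p y)
            ∂(latentLaw ν f ρ p) := by
  obtain ⟨ρ, hρ, hmap⟩ := hVWX.exists_map_eq hN hf hΛ
  refine ⟨ρ, hρ, fun H hH => ?_⟩
  have hmeas : Measurable fun ω => ((W ω, X ω), V ω) :=
    (hVWX.measurable_W.prodMk hVWX.measurable_X).prodMk hVWX.measurable_V
  have hG : Measurable fun z : ((Fin n → ℝ) × (Fin n → ℝ)) × (Fin n → 𝓥) =>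
      H ((tiePartition z.2, z.1), z.2) :=
    hH.comp (((measurable_tiePartition.comp measurable_snd).prodMk measurable_fst).prodMk
      measurable_snd)
  have h1 : ∫⁻ ω, H ((tiePartition (V ω), W ω, X ω), V ω) ∂P =
      ∫⁻ z, H ((tiePartition z.2, z.1), z.2) ∂(P.map fun ω => ((W ω, X ω), V ω)) :=
    (lintegral_map hG hmeas).symm
  rw [h1, hmap, lintegral_finsetSum_measure]
  refine Finset.sum_congr rfl fun p _ => ?_
  rw [Measure.lintegral_compProd hG]
  refine lintegral_congr_ae ?_
  -- In the component with index `p` the cells almost surely have positive finite mass, so the ties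
  -- of `v` reproduce `p`.
  filter_upwards [ae_latentLaw_regular hf hΛ hρ p] with y hy
  refine lintegral_congr_ae ?_
  have hae : ∀ᵐ v ∂(cellsKernel (ν := ν) hf p y), tiePartition v = p :=
    ae_tiePartition_cellsLaw hy.2
  filter_upwards [hae] with v hv
  rw [hv]

end Law

/-! ### Disintegration of the joint law. -/

section Conditional

variable {n : ℕ} {𝓥 : Type*} [MeasurableSpace 𝓥] {ν : Measure 𝓥} {f : Fin n → 𝓥 → ℝ≥0}
  {Ω₀ : Type*} [MeasurableSpace Ω₀] {N : Ω₀ → Measure 𝓥} {P₀ : Measure Ω₀}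
  {k : ℕ} {μ Δ a₀ : ℝ} {a β : Fin k → ℝ}

/-- The law of `V` given `(p, W, X)`, as a kernel. -/
def valuesKernel [Nonempty 𝓥] [SFinite ν] (hf : ∀ i, Measurable (f i)) :
    Kernel (Setoid (Fin n) × (Fin n → ℝ) × (Fin n → ℝ)) (Fin n → 𝓥) where
  toFun z := cellsKernel (ν := ν) hf z.1 z.2
  measurable' := measurable_from_prod_countable_right fun p => (cellsKernel hf p).measurable

instance [Nonempty 𝓥] [SFinite ν] (hf : ∀ i, Measurable (f i)) :
    IsMarkovKernel (valuesKernel (ν := ν) hf) :=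
  ⟨fun z => inferInstanceAs (IsProbabilityMeasure (cellsKernel (ν := ν) hf z.1 z.2))⟩

/-- The sum of the weights of all partitions. -/
def totalWeight (ν : Measure 𝓥) (f : Fin n → 𝓥 → ℝ≥0) (w : Fin n → ℝ) : ℝ≥0∞ :=
  ∑ q : Setoid (Fin n), partitionWeight ν f w q

lemma measurable_totalWeight [SFinite ν] (hf : ∀ i, Measurable (f i)) :
    Measurable fun w => totalWeight ν f w :=
  Finset.measurable_fun_sum _ fun q _ => measurable_partitionWeight hf q

lemma totalWeight_lt_top (hf : ∀ i, Measurable (f i))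
    (hΛ : ∀ w : Fin n → ℝ, (∀ i, 0 ≤ w i) → Lam ν (Omega f w) < ∞)
    {w : Fin n → ℝ} (hw : ∀ i, 0 < w i) : totalWeight ν f w < ∞ :=
  ENNReal.sum_lt_top.2 fun p _ => partitionWeight_lt_top hf hΛ hw p

lemma totalWeight_pos {w : Fin n → ℝ} {p : Setoid (Fin n)} (h : IsRegularAt ν f p w) :
    0 < totalWeight ν f w := by
  refine lt_of_lt_of_le (pos_iff_ne_zero.2 (Finset.prod_ne_zero_iff.2 fun j _ => (h j).1.ne'))
    (Finset.single_le_sum (f := fun q => partitionWeight ν f w q) (fun _ _ => zero_le)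
      (Finset.mem_univ p))

open Classical in
/-- The law of the partition given `W = w`. -/
def partitionLaw (ν : Measure 𝓥) (f : Fin n → 𝓥 → ℝ≥0) (w : Fin n → ℝ) :
    Measure (Setoid (Fin n)) :=
  if 0 < totalWeight ν f w ∧ totalWeight ν f w < ∞ then
    ∑ p : Setoid (Fin n), (partitionWeight ν f w p / totalWeight ν f w) • Measure.dirac p
  else Measure.dirac ⊥

lemma partitionLaw_of_pos {w : Fin n → ℝ} (h : 0 < totalWeight ν f w ∧ totalWeight ν f w < ∞) :
    partitionLaw ν f w =
      ∑ p : Setoid (Fin n), (partitionWeight ν f w p / totalWeight ν f w) • Measure.dirac p :=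
  if_pos h

lemma lintegral_partitionLaw {w : Fin n → ℝ}
    (h : 0 < totalWeight ν f w ∧ totalWeight ν f w < ∞) (F : Setoid (Fin n) → ℝ≥0∞) :
    ∫⁻ q, F q ∂(partitionLaw ν f w) =
      ∑ q : Setoid (Fin n), partitionWeight ν f w q / totalWeight ν f w * F q := by
  rw [partitionLaw_of_pos h, lintegral_finsetSum_measure]
  simp only [lintegral_smul_measure, lintegral_dirac, smul_eq_mul]

lemma partitionLaw_singleton {w : Fin n → ℝ}
    (h : 0 < totalWeight ν f w ∧ totalWeight ν f w < ∞) (p : Setoid (Fin n)) :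
    partitionLaw ν f w {p} = partitionWeight ν f w p / totalWeight ν f w := by
  classical
  rw [← lintegral_indicator_one (measurableSet_singleton p), lintegral_partitionLaw h]
  simp [indicator_apply]

instance (w : Fin n → ℝ) : IsProbabilityMeasure (partitionLaw ν f w) := by
  by_cases h : 0 < totalWeight ν f w ∧ totalWeight ν f w < ∞
  · refine ⟨?_⟩
    rw [← lintegral_one, lintegral_partitionLaw h]
    simp only [mul_one, div_eq_mul_inv]
    rw [← Finset.sum_mul]
    exact ENNReal.mul_inv_cancel h.1.ne' h.2.ne
  · rw [partitionLaw, if_neg h]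
    infer_instance

/-- The law of the partition given `(W, X)`, as a kernel. -/
def partitionKernel [SFinite ν] (hf : ∀ i, Measurable (f i)) :
    Kernel ((Fin n → ℝ) × (Fin n → ℝ)) (Setoid (Fin n)) where
  toFun y := partitionLaw ν f y.1
  measurable' := by
    classical
    refine Measurable.comp (g := fun w => partitionLaw ν f w) ?_ measurable_fst
    refine Measurable.ite ?_ ?_ measurable_const
    · exact (measurable_totalWeight hf) measurableSet_Ioo
    · refine Measure.measurable_of_measurable_coe _ fun s hs => ?_
      simp only [Measure.finsetSum_apply, Measure.smul_apply, smul_eq_mul]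
      exact Finset.measurable_fun_sum _ fun p _ =>
        ((measurable_partitionWeight hf p).div (measurable_totalWeight hf)).mul_const _

instance [SFinite ν] (hf : ∀ i, Measurable (f i)) : IsMarkovKernel (partitionKernel (ν := ν) hf) :=
  ⟨fun y => inferInstanceAs (IsProbabilityMeasure (partitionLaw ν f y.1))⟩

lemma IsAugmentedSample.measurable_tiePartition_comp [MeasurableEq 𝓥] {Ω : Type*}
    [MeasurableSpace Ω] {P : Measure Ω} {V : Ω → Fin n → 𝓥} {W X : Ω → Fin n → ℝ}
    (hVWX : IsAugmentedSample P₀ N f μ Δ a₀ a β P V W X) :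
    Measurable fun ω => tiePartition (V ω) :=
  measurable_tiePartition.comp hVWX.measurable_V

lemma IsAugmentedSample.measurable_partition [MeasurableEq 𝓥] {Ω : Type*} [MeasurableSpace Ω]
    {P : Measure Ω} {V : Ω → Fin n → 𝓥} {W X : Ω → Fin n → ℝ}
    (hVWX : IsAugmentedSample P₀ N f μ Δ a₀ a β P V W X) :
    Measurable fun ω => (tiePartition (V ω), W ω, X ω) :=
  hVWX.measurable_tiePartition_comp.prodMk (hVWX.measurable_W.prodMk hVWX.measurable_X)

variable [Nonempty 𝓥] [SigmaFinite ν] [NullSingletonClass ν]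
  [MeasurableEq 𝓥] [MeasurableSingletonClass 𝓥] [IsProbabilityMeasure P₀]
  {Ω : Type*} [MeasurableSpace Ω] {P : Measure Ω} [IsProbabilityMeasure P]
  {V : Ω → Fin n → 𝓥} {W X : Ω → Fin n → ℝ}

/-- The density of the component `p` contains the weight of `p`, so points where that weight
vanishes are not charged. -/
lemma IsAugmentedSample.ae_regular (hN : IsPoissonRandomMeasure N ν P₀)
    (hf : ∀ i, Measurable (f i))
    (hΛ : ∀ w : Fin n → ℝ, (∀ i, 0 ≤ w i) → Lam ν (Omega f w) < ∞)
    (hVWX : IsAugmentedSample P₀ N f μ Δ a₀ a β P V W X) :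
    ∀ᵐ ω ∂P, (∀ i, 0 < W ω i) ∧ IsRegularAt ν f (tiePartition (V ω)) (W ω) := by
  obtain ⟨ρ, hρ, hlaw⟩ := hVWX.exists_lintegral_eq hN hf hΛ
  set S : Set (Setoid (Fin n) × (Fin n → ℝ) × (Fin n → ℝ)) :=
    {z | (∀ i, 0 < z.2.1 i) ∧ IsRegularAt ν f z.1 z.2.1} with hS
  have hpos : MeasurableSet {w : Fin n → ℝ | ∀ i, 0 < w i} := by
    simp only [ofPred_forall]
    exact MeasurableSet.iInter fun i => measurableSet_lt measurable_const (measurable_pi_apply i)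
  have hSm : MeasurableSet S := by
    have : S = ⋃ p : Setoid (Fin n),
        {p} ×ˢ (({w | ∀ i, 0 < w i} ∩ {w | IsRegularAt ν f p w}) ×ˢ univ) := by
      ext ⟨p, w, x⟩
      simp [hS]
    rw [this]
    exact MeasurableSet.iUnion fun p => (measurableSet_singleton p).prod
      ((hpos.inter (measurableSet_isRegularAt hf p)).prod MeasurableSet.univ)
  have h := hlaw (fun z => Sᶜ.indicator 1 z.1)
    ((measurable_one.indicator hSm.compl).comp measurable_fst)
  have h0 : ∑ p : Setoid (Fin n), ∫⁻ y, ∫⁻ _v : Fin n → 𝓥, Sᶜ.indicator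
      (1 : Setoid (Fin n) × (Fin n → ℝ) × (Fin n → ℝ) → ℝ≥0∞) (p, y)
      ∂(cellsKernel (ν := ν) hf p y) ∂(latentLaw ν f ρ p) = 0 := by
    refine Finset.sum_eq_zero fun p _ => ?_
    rw [lintegral_congr_ae (g := fun _ => 0), lintegral_zero]
    filter_upwards [ae_latentLaw_regular hf hΛ hρ p] with y hy
    have : (p, y) ∉ Sᶜ := fun hn => hn hy
    simp only [indicator_of_notMem this, lintegral_zero]
  have hm : Measurable fun ω => Sᶜ.indicator
      (1 : Setoid (Fin n) × (Fin n → ℝ) × (Fin n → ℝ) → ℝ≥0∞) (tiePartition (V ω), W ω, X ω) :=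
    (measurable_one.indicator hSm.compl).comp hVWX.measurable_partition
  rw [h0, lintegral_eq_zero_iff hm] at h
  filter_upwards [h] with ω hω
  by_contra hn
  have hmem : (tiePartition (V ω), W ω, X ω) ∈ Sᶜ := hn
  exact one_ne_zero ((indicator_of_mem hmem 1).symm.trans hω)

/-- The joint law is applied to `H` and to its average over the kernel. The average no longer
depends on `v`, and integrating it against a Markov kernel leaves it unchanged. -/
lemma IsAugmentedSample.map_values_eq (hN : IsPoissonRandomMeasure N ν P₀)
    (hf : ∀ i, Measurable (f i))
    (hΛ : ∀ w : Fin n → ℝ, (∀ i, 0 ≤ w i) → Lam ν (Omega f w) < ∞)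
    (hVWX : IsAugmentedSample P₀ N f μ Δ a₀ a β P V W X) :
    P.map (fun ω => ((tiePartition (V ω), W ω, X ω), V ω)) =
      P.map (fun ω => (tiePartition (V ω), W ω, X ω)) ⊗ₘ valuesKernel (ν := ν) hf := by
  obtain ⟨ρ, hρ, hlaw⟩ := hVWX.exists_lintegral_eq hN hf hΛ
  refine Measure.ext_of_lintegral _ fun H hH => ?_
  have hHm : Measurable fun z => ∫⁻ v, H (z, v) ∂(valuesKernel (ν := ν) hf z) :=
    Measurable.lintegral_kernel_prod_right' hH
  rw [lintegral_map hH (hVWX.measurable_partition.prodMk hVWX.measurable_V),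
    Measure.lintegral_compProd hH, lintegral_map hHm hVWX.measurable_partition, hlaw H hH,
    hlaw (fun z => ∫⁻ v, H (z.1, v) ∂(valuesKernel (ν := ν) hf z.1)) (hHm.comp measurable_fst)]
  simp only [lintegral_const, measure_univ, mul_one]
  rfl

/-- The sum over `p` is moved inside the integral over `(w, x)`, where each weight is the total
weight times its normalised value. -/
lemma IsAugmentedSample.map_partition_eq (hN : IsPoissonRandomMeasure N ν P₀)
    (hf : ∀ i, Measurable (f i))
    (hΛ : ∀ w : Fin n → ℝ, (∀ i, 0 ≤ w i) → Lam ν (Omega f w) < ∞)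
    (hVWX : IsAugmentedSample P₀ N f μ Δ a₀ a β P V W X) :
    P.map (fun ω => ((W ω, X ω), tiePartition (V ω))) =
      P.map (fun ω => (W ω, X ω)) ⊗ₘ partitionKernel (ν := ν) hf := by
  obtain ⟨ρ, hρ, hlaw⟩ := hVWX.exists_lintegral_eq hN hf hΛ
  have hWX : Measurable fun ω => (W ω, X ω) := hVWX.measurable_W.prodMk hVWX.measurable_X
  have hsum : ∀ G : Setoid (Fin n) × ((Fin n → ℝ) × (Fin n → ℝ)) → ℝ≥0∞, Measurable G →
      ∫⁻ ω, G (tiePartition (V ω), W ω, X ω) ∂P = ∫⁻ y, ρ y * ∑ p : Setoid (Fin n),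
        partitionWeight ν f y.1 p * G (p, y) ∂(latentVolume n) := by
    intro G hG
    have hGm : ∀ p : Setoid (Fin n), Measurable fun y => G (p, y) := fun p =>
      hG.comp measurable_prodMk_left
    have hwt : ∀ p : Setoid (Fin n), Measurable fun y : (Fin n → ℝ) × (Fin n → ℝ) =>
        ρ y * partitionWeight ν f y.1 p := fun p =>
      hρ.mul ((measurable_partitionWeight hf p).comp measurable_fst)
    have hm : ∀ p : Setoid (Fin n), Measurable fun y : (Fin n → ℝ) × (Fin n → ℝ) =>
        ρ y * partitionWeight ν f y.1 p * G (p, y) := fun p => (hwt p).mul (hGm p)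
    rw [hlaw (fun z => G z.1) (hG.comp measurable_fst)]
    simp only [lintegral_const, measure_univ, mul_one, Finset.mul_sum, ← mul_assoc]
    rw [lintegral_finsetSum _ fun p _ => hm p]
    refine Finset.sum_congr rfl fun p _ => ?_
    rw [latentLaw, lintegral_withDensity_eq_lintegral_mul _ (hwt p) (hGm p)]
    rfl
  refine Measure.ext_of_lintegral _ fun H hH => ?_
  have hHm : Measurable fun y => ∫⁻ q, H (y, q) ∂(partitionKernel (ν := ν) hf y) :=
    Measurable.lintegral_kernel_prod_right' hH
  rw [lintegral_map hH (hWX.prodMk hVWX.measurable_tiePartition_comp),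
    Measure.lintegral_compProd hH, lintegral_map hHm hWX,
    hsum (fun z => H (z.2, z.1)) (hH.comp measurable_swap),
    hsum (fun z => ∫⁻ q, H (z.2, q) ∂(partitionKernel (ν := ν) hf z.2)) (hHm.comp measurable_snd)]
  refine lintegral_congr_ae ?_
  filter_upwards [ae_latentVolume_pos] with y hy
  congr 1
  rw [← Finset.sum_mul]
  change _ = totalWeight ν f y.1 * ∫⁻ q, H (y, q) ∂(partitionLaw ν f y.1)
  have htop := totalWeight_lt_top hf hΛ hy
  -- If the total weight vanishes, so does every weight, and the default law is irrelevant;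
  -- otherwise the normalisation cancels.
  rcases eq_or_ne (totalWeight ν f y.1) 0 with h0 | h0
  · rw [h0, zero_mul]
    refine Finset.sum_eq_zero fun p hp => ?_
    rw [Finset.sum_eq_zero_iff.1 h0 p hp, zero_mul]
  · rw [lintegral_partitionLaw ⟨pos_iff_ne_zero.2 h0, htop⟩, Finset.mul_sum]
    refine Finset.sum_congr rfl fun p _ => ?_
    rw [← mul_assoc, ENNReal.mul_div_cancel h0 htop.ne]

end Conditional

end GHVolatility

end

/-! ### The two conditional laws. -/

open GHVolatility in
theorem proposition3p1
    {𝓥 : Type*} [TopologicalSpace 𝓥] [PolishSpace 𝓥] [MeasurableSpace 𝓥] [BorelSpace 𝓥]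
    [Nonempty 𝓥]
    (ν : Measure 𝓥) [SigmaFinite ν] [NullSingletonClass ν]
    {Ω₀ : Type*} [MeasurableSpace Ω₀] (P₀ : Measure Ω₀) [IsProbabilityMeasure P₀]
    (N : Ω₀ → Measure 𝓥) (hN : IsPoissonRandomMeasure N ν P₀)
    (n : ℕ) (f : Fin n → 𝓥 → ℝ≥0) (hf : ∀ i, Measurable (f i))
    (hΛ : ∀ w : Fin n → ℝ, (∀ i, 0 ≤ w i) → Lam ν (Omega f w) < ∞)
    (μ Δ a₀ : ℝ) (k : ℕ) (a β : Fin k → ℝ)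
    {Ω : Type*} [MeasurableSpace Ω] (P : Measure Ω) [IsProbabilityMeasure P]
    (V : Ω → Fin n → 𝓥) (W X : Ω → Fin n → ℝ)
    (hVWX : IsAugmentedSample P₀ N f μ Δ a₀ a β P V W X) :
    -- law of `V` given `(p, W, X)`: the values on the cells of `p` are independent
    (∀ᵐ z ∂(P.map fun ω => (tiePartition (V ω), W ω, X ω)),
      (∀ j : Quotient z.1, 0 < cellMass ν f z.2.1 (cell z.1 j) ∧
        cellMass ν f z.2.1 (cell z.1 j) < ∞) ∧
      condDistrib V (fun ω => (tiePartition (V ω), W ω, X ω)) P z =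
        (Measure.pi fun j : Quotient z.1 => cellLaw ν f z.2.1 (cell z.1 j)).map (spread z.1)) ∧
    -- law of `p` given `(W, X)`
    (∀ᵐ z ∂(P.map fun ω => (W ω, X ω)),
      (0 < ∑ q : Setoid (Fin n), partitionWeight ν f z.1 q ∧
        ∑ q : Setoid (Fin n), partitionWeight ν f z.1 q < ∞) ∧
      ∀ p : Setoid (Fin n),
        condDistrib (fun ω => tiePartition (V ω)) (fun ω => (W ω, X ω)) P z {p} =
          partitionWeight ν f z.1 p / ∑ q : Setoid (Fin n), partitionWeight ν f z.1 q) := by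
  have hZ := hVWX.measurable_partition
  have hWX : Measurable fun ω => (W ω, X ω) := hVWX.measurable_W.prodMk hVWX.measurable_X
  have hreg := hVWX.ae_regular hN hf hΛ
  constructor
  · have hpos : ∀ᵐ z ∂(P.map fun ω => (tiePartition (V ω), W ω, X ω)),
        IsRegularAt ν f z.1 z.2.1 := by
      have hm : MeasurableSet {z : Setoid (Fin n) × (Fin n → ℝ) × (Fin n → ℝ) |
          IsRegularAt ν f z.1 z.2.1} := by
        have : {z : Setoid (Fin n) × (Fin n → ℝ) × (Fin n → ℝ) | IsRegularAt ν f z.1 z.2.1} =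
            ⋃ p : Setoid (Fin n), {p} ×ˢ ({w | IsRegularAt ν f p w} ×ˢ univ) := by
          ext ⟨p, w, x⟩
          simp
        rw [this]
        exact MeasurableSet.iUnion fun p => (measurableSet_singleton p).prod
          ((measurableSet_isRegularAt hf p).prod MeasurableSet.univ)
      rw [ae_map_iff hZ.aemeasurable hm]
      filter_upwards [hreg] with ω hω using hω.2
    -- Conditional distributions are almost surely unique, so the disintegrating kernel is the
    -- conditional law; at regular points its default branch is not taken.
    filter_upwards [hpos, condDistrib_ae_eq_of_measure_eq_compProd _
      hVWX.measurable_V.aemeasurable (hVWX.map_values_eq hN hf hΛ)] with z hz hcond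
    exact ⟨hz, hcond.trans (cellsLaw_of_isRegularAt hz)⟩
  · have hpos : ∀ᵐ z ∂(P.map fun ω => (W ω, X ω)),
        0 < totalWeight ν f z.1 ∧ totalWeight ν f z.1 < ∞ := by
      have hm : MeasurableSet {z : (Fin n → ℝ) × (Fin n → ℝ) |
          0 < totalWeight ν f z.1 ∧ totalWeight ν f z.1 < ∞} :=
        ((measurable_totalWeight hf).comp measurable_fst) measurableSet_Ioo
      rw [ae_map_iff hWX.aemeasurable hm]
      filter_upwards [hreg] with ω hω using ⟨totalWeight_pos hω.2, totalWeight_lt_top hf hΛ hω.1⟩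
    filter_upwards [hpos, condDistrib_ae_eq_of_measure_eq_compProd _
      hVWX.measurable_tiePartition_comp.aemeasurable
      (hVWX.map_partition_eq hN hf hΛ)] with z hz hcond
    refine ⟨hz, fun p => ?_⟩
    exact (congrArg (fun m : Measure (Setoid (Fin n)) => m {p}) hcond).trans
      (partitionLaw_singleton hz p)
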